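/- Let $p$ be a prime, $n\ge 0$ an integer and $K$ an arbitrary field of characteristic $p$. For a finite abelian group $A$, a twist for the group algebra $K[A]$ (a Hopf algebra with coproduct $\Delta$ and counit $\varepsilon$) is an invertible element $J\in K[A]\otimes_K K[A]$ such that $$(\Delta\otimes \mathrm{id})(J)\,(J\otimes 1)=(\mathrm{id}\otimes\Delta)(J)\,(1\otimes J),\qquad (\varepsilon\otimes\mathrm{id})(J)=1=(\mathrm{id}\otimes\varepsilon)(J).$$ Two twists $I,J$ are gauge equivalent if $J=\Delta(x)\,I\,(x^{-1}\otimes x^{-1})$ for some invertible $x\in K[A]$ with $\varepsilon(x)=1$. Let $H^2_{\rm inv}(A,K)$ be the group of gauge equivalence classes of twists for $K[A]$, with multiplication induced by that of $K[A]\otimes_K K[A]$. Let $W_n(K)$ be the ring of ($p$-typical) truncated Witt vectors of length $n$ over $K$, and let $\mathscr{P}:W_n(K)\to W_n(K)$ be the additive homomorphism $\mathscr{P}(x)=F(x)-x$, where $F(x_0,\dots,x_{n-1})=(x_0^p,\dots,x_{n-1}^p)$. Then there is a group isomorphism $$H^2_{\rm inv}(\mathbb{Z}/p^n\mathbb{Z},K)\cong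 W_n(K)/\mathscr{P}(W_n(K)).$$ In particular, for every finite field $\mathbb{F}_q$ of characteristic $p$ there is a group isomorphism $$H^2_{\rm inv}(\mathbb{Z}/p^n\mathbb{Z},\mathbb{F}_q)\cong \mathbb{Z}/p^n\mathbb{Z}.$$ -/

import Mathlib

open scoped TensorProduct

/-! ### Twists for a commutative Hopf algebra and their gauge equivalence classes -/

section Twists

variable (K H : Type*) [CommRing K] [CommRing H] [HopfAlgebra K H]

/-- `Δ ⊗ id : H ⊗ H → H ⊗ H ⊗ H`, with `H ⊗ H ⊗ H` bracketed as `H ⊗ (H ⊗ H)`. -/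
noncomputable def comulLeft : H ⊗[K] H →ₐ[K] H ⊗[K] (H ⊗[K] H) :=
  (Algebra.TensorProduct.assoc K K K H H H).toAlgHom.comp
    (Algebra.TensorProduct.map (Bialgebra.comulAlgHom K H) (AlgHom.id K H))

/-- `id ⊗ Δ : H ⊗ H → H ⊗ H ⊗ H`. -/
noncomputable def comulRight : H ⊗[K] H →ₐ[K] H ⊗[K] (H ⊗[K] H) :=
  Algebra.TensorProduct.map (AlgHom.id K H) (Bialgebra.comulAlgHom K H)

/-- The map `J ↦ J ⊗ 1`, from `H ⊗ H` to `H ⊗ H ⊗ H`. -/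
noncomputable def tensorOne : H ⊗[K] H →ₐ[K] H ⊗[K] (H ⊗[K] H) :=
  (Algebra.TensorProduct.assoc K K K H H H).toAlgHom.comp
    (Algebra.TensorProduct.includeLeft : H ⊗[K] H →ₐ[K] (H ⊗[K] H) ⊗[K] H)

/-- The map `J ↦ 1 ⊗ J`, from `H ⊗ H` to `H ⊗ H ⊗ H`. -/
noncomputable def oneTensor : H ⊗[K] H →ₐ[K] H ⊗[K] (H ⊗[K] H) :=
  Algebra.TensorProduct.includeRight

/-- `ε ⊗ id : H ⊗ H → K ⊗ H = H`. -/
noncomputable def counitLeft : H ⊗[K] H →ₐ[K] H :=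
  (Algebra.TensorProduct.lid K H).toAlgHom.comp
    (Algebra.TensorProduct.map (Bialgebra.counitAlgHom K H) (AlgHom.id K H))

/-- `id ⊗ ε : H ⊗ H → H ⊗ K = H`. -/
noncomputable def counitRight : H ⊗[K] H →ₐ[K] H :=
  (Algebra.TensorProduct.rid K K H).toAlgHom.comp
    (Algebra.TensorProduct.map (AlgHom.id K H) (Bialgebra.counitAlgHom K H))

variable {K H} in
/-- An invertible element `J` of `H ⊗ H` is a twist for `H` if
`(Δ ⊗ id)(J) (J ⊗ 1) = (id ⊗ Δ)(J) (1 ⊗ J)` and `(ε ⊗ id)(J) = 1 = (id ⊗ ε)(J)`. -/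
structure IsTwist (J : (H ⊗[K] H)ˣ) : Prop where
  cocycle : comulLeft K H J * tensorOne K H J = comulRight K H J * oneTensor K H J
  counit_left : counitLeft K H J = 1
  counit_right : counitRight K H J = 1

/-- Since `H` is commutative, the twists form a group under multiplication in `H ⊗ H`. -/
def twistGroup : Subgroup (H ⊗[K] H)ˣ where
  carrier := {J | IsTwist J}
  one_mem' := ⟨by simp, by simp, by simp⟩
  mul_mem' := by
    rintro I J ⟨h1, h2, h3⟩ ⟨k1, k2, k3⟩
    refine ⟨?_, by simp [h2, k2], by simp [h3, k3]⟩
    simp only [Units.val_mul, map_mul]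
    rw [mul_mul_mul_comm, h1, k1, mul_mul_mul_comm]
  inv_mem' := by
    rintro J ⟨h1, h2, h3⟩
    have key : ∀ {S : Type _} [CommRing S] [Algebra K S] (f : H ⊗[K] H →ₐ[K] S),
        f J * f ((J⁻¹ : (H ⊗[K] H)ˣ) : H ⊗[K] H) = 1 := by
      intro S _ _ f
      rw [← map_mul, Units.mul_inv, map_one]
    refine ⟨?_, by simpa [h2] using key (counitLeft K H), by simpa [h3] using key (counitRight K H)⟩
    refine inv_unique (x := comulLeft K H J * tensorOne K H J) ?_ ?_
    · rw [mul_mul_mul_comm, key, key, one_mul]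
    · rw [h1, mul_mul_mul_comm, key, key, one_mul]

variable {K H} in
/-- The element `Δ(x) J (x⁻¹ ⊗ x⁻¹)`, the gauge transform of `J` by the invertible element `x`. -/
noncomputable def gaugeTransform (x : Hˣ) (J : (H ⊗[K] H)ˣ) : (H ⊗[K] H)ˣ :=
  Units.map (Bialgebra.comulAlgHom K H : H →* H ⊗[K] H) x * J *
    (Units.map (Algebra.TensorProduct.includeLeft : H →ₐ[K] H ⊗[K] H) x⁻¹ *
      Units.map (Algebra.TensorProduct.includeRight : H →ₐ[K] H ⊗[K] H) x⁻¹)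

variable {K H} in
/-- Two twists `I` and `J` are gauge equivalent if `J = Δ(x) I (x⁻¹ ⊗ x⁻¹)` for some invertible
`x` with `ε(x) = 1` (this normalization is forced by `(ε ⊗ id)(I) = (ε ⊗ id)(J) = 1`). -/
def GaugeEquivalent (I J : (H ⊗[K] H)ˣ) : Prop :=
  ∃ x : Hˣ, Coalgebra.counit (R := K) (x : H) = 1 ∧ J = gaugeTransform x I

/-- The gauge equivalence is a congruence on the group of twists. -/
noncomputable def gaugeCon : Con (twistGroup K H) where
  r I J := GaugeEquivalent (I : (H ⊗[K] H)ˣ) (J : (H ⊗[K] H)ˣ)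
  iseqv := by
    refine ⟨fun I => ⟨1, by simp, by simp [gaugeTransform]⟩, ?_, ?_⟩
    · rintro I J ⟨x, hx, h⟩
      refine ⟨x⁻¹, ?_, ?_⟩
      · have e := congrArg (Bialgebra.counitAlgHom K H) x.inv_mul
        rw [map_mul, map_one, Bialgebra.counitAlgHom_apply, Bialgebra.counitAlgHom_apply, hx,
          mul_one] at e
        exact e
      · rw [h]
        simp only [gaugeTransform, map_inv, inv_inv]
        rw [mul_assoc (Units.map (Bialgebra.comulAlgHom K H : H →* H ⊗[K] H) x),
          inv_mul_cancel_left, mul_assoc, ← mul_inv, inv_mul_cancel, mul_one]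
    · rintro I J L ⟨x, hx, h⟩ ⟨y, hy, k⟩
      refine ⟨y * x, by simp [hx, hy], ?_⟩
      rw [k, h]
      simp only [gaugeTransform, map_mul, mul_inv]
      ac_rfl
  mul' := by
    rintro I J I' J' ⟨x, hx, h⟩ ⟨y, hy, k⟩
    refine ⟨x * y, by simp [hx, hy], ?_⟩
    rw [Subgroup.coe_mul, Subgroup.coe_mul, k, h]
    simp only [gaugeTransform, map_mul, mul_inv]
    ac_rfl

/-- The group of gauge equivalence classes of twists for the commutative Hopf algebra `H`. -/
abbrev TwistClasses : Type _ := (gaugeCon K H).Quotient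

end Twists

/-- `H²_inv(A, K)`: the group of gauge equivalence classes of twists for the group algebra `K[A]`
of the commutative group `A`. -/
abbrev H2inv (A K : Type*) [CommGroup A] [Field K] : Type _ :=
  TwistClasses K (MonoidAlgebra K A)

/-! ### Truncated Witt vectors -/

section Witt

variable (p n : ℕ) [Fact p.Prime] (R : Type*) [CommRing R] [CharP R p]

/-- The Frobenius `F (x₀, …, xₙ₋₁) = (x₀ ^ p, …, xₙ₋₁ ^ p)` of `W_n(R)`. -/
def wittFrobeniusFun (x : TruncatedWittVector p n R) : TruncatedWittVector p n R :=
  TruncatedWittVector.mk p fun i => x.coeff i ^ p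


theorem wittFrobeniusFun_truncate (x : WittVector p R) :
    wittFrobeniusFun p n R (WittVector.truncate n x) =
      WittVector.truncate n (WittVector.frobenius x) := by
  ext i
  simp [wittFrobeniusFun, WittVector.coeff_frobenius_charP]

/-- `F` as an additive homomorphism. -/
noncomputable def wittFrobenius : TruncatedWittVector p n R →+ TruncatedWittVector p n R :=
  AddMonoidHom.mk' (wittFrobeniusFun p n R) fun x y => by
    obtain ⟨x, rfl⟩ := WittVector.truncate_surjective p n R x
    obtain ⟨y, rfl⟩ := WittVector.truncate_surjective p n R y
    simp only [← map_add, wittFrobeniusFun_truncate]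

/-- The additive homomorphism `℘ : W_n(R) → W_n(R)`, `℘(x) = F(x) - x`. -/
noncomputable def wittP : TruncatedWittVector p n R →+ TruncatedWittVector p n R :=
  wittFrobenius p n R - AddMonoidHom.id _

end Witt

/-!
# Twists of the group algebra of `ℤ/pⁿℤ` in characteristic `p`

Over a separable closure `L` of `K` a twist `J` becomes a coboundary, `J = Δ(x) (x ⊗ x)⁻¹`, and a
Witt vector `w` becomes `F(y) - y`. The Galois group moves `x` by elements of the group and `y` by
elements of `W_n(𝔽_p) = ℤ/pⁿℤ`; matching these two characters gives the isomorphism.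
-/

/-! Write `G = ℤ/pⁿℤ` and let `L` be a separable closure of `K`. On elements of augmentation `1` of
`L[G]`, which are units, the map `x ↦ Δ(x) (x ⊗ x)⁻¹` has the group-like elements, that is `G`, as
its kernel. On `W_n(L)` the map `F - 1` has kernel `W_n(𝔽_p) = ℤ/pⁿℤ`. A twist, or a Witt vector,
over `K` therefore yields a continuous character of the Galois group with values in `ℤ/pⁿℤ`. The
group of characters is never formed: pairs (twist, Witt vector) with a common character make up a
subgroup `Γ` (`relatedSubgroup`). It surjects onto both factors (`exists_related_right`,
`exists_related_left`), and in a related pair one class is trivial exactly when the other is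
(`Related.exists_splits_iff`), so both groups of classes are the same quotient of `Γ`.

Three facts carry this. First, twists split over `L` (`IsCocycle.exists_splits`). A twist `J` is
symmetric, because its quotient by its flip is multiplicative in one variable, hence given by
idempotents of a group algebra that has only scalar ones (`IsCocycle.push_swap`). A symmetric `J`
deforms the function algebra of `G` into a finite commutative algebra `TwistedFun` whose points are
the inverses of splittings; it is unramified, so it has a point over `L`. Second, `F - 1` is onto on
`W_n(L)` (`exists_wittP_eq`), by Artin-Schreier equations one coefficient at a time. Third, every
continuous character is a coboundary on both sides (`exists_of_character`), by averaging a trace-one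
element.

Over a finite field the cokernel of `F - 1` is as large as its kernel, namely `pⁿ`, and a
Teichmüller class of order `pⁿ` makes it cyclic. -/

open scoped MonoidAlgebra

namespace TwistCohomology

open MonoidAlgebra

/-! ### Group algebras, augmentation and group-like elements -/

section Basic

variable {R S : Type*} [CommRing R] [CommRing S] {G H N : Type*} [CommGroup G] [CommGroup H]
  [CommGroup N]

/-- Functoriality of the group algebra in the group. -/
noncomputable abbrev push (R : Type*) [CommRing R] (f : G →* H) : R[G] →+* R[H] :=
  mapDomainRingHom R f

/-- Functoriality of the group algebra in the coefficients. -/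
noncomputable abbrev coeffMap (G : Type*) [CommGroup G] (f : R →+* S) : R[G] →+* S[G] :=
  mapRingHom G f

theorem push_single (f : G →* H) (g : G) (r : R) :
    push R f (single g r) = single (f g) r := by simp

theorem push_push (f : G →* H) (h : H →* N) (x : R[G]) :
    push R h (push R f x) = push R (h.comp f) x := by
  simp only [push, mapDomainRingHom_comp, RingHom.comp_apply]

theorem coeffMap_push (φ : R →+* S) (f : G →* H) (x : R[G]) :
    coeffMap H φ (push R f x) = push S f (coeffMap G φ x) :=
  DFunLike.congr_fun (mapRingHom_comp_mapDomainRingHom φ f) x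

variable (R G) in
/-- The augmentation of a group algebra. -/
noncomputable def aug : R[G] →ₐ[R] R := MonoidAlgebra.lift R R G 1

@[simp]
theorem aug_single (g : G) (r : R) : aug R G (single g r) = r := by simp [aug]

theorem aug_push (f : G →* H) (x : R[G]) : aug R H (push R f x) = aug R G x := by
  induction x using MonoidAlgebra.induction_linear with
  | zero => simp
  | add x y hx hy => simp only [map_add, hx, hy]
  | single g r => rw [push_single, aug_single, aug_single]

theorem aug_coeffMap (φ : R →+* S) (x : R[G]) : aug S G (coeffMap G φ x) = φ (aug R G x) := by
  induction x using MonoidAlgebra.induction_linear with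
  | zero => simp
  | add x y hx hy => simp only [map_add, hx, hy]
  | single g r => simp

theorem aug_eq_sum [Fintype G] (x : R[G]) : aug R G x = ∑ g, x.coeff g := by
  classical
  induction x using MonoidAlgebra.induction_linear with
  | zero => simp
  | add x y hx hy => simp [hx, hy, Finset.sum_add_distrib]
  | single g r => simp [Finsupp.single_apply]

/-- In characteristic `p`, the `q`-th power map on the group algebra of a group of exponent
dividing the `p`-power `q` is the augmentation followed by the `q`-th power map. -/
theorem pow_eq_single_aug_pow (p k : ℕ) [Fact p.Prime] [CharP R p] (hG : ∀ g : G, g ^ p ^ k = 1)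
    (x : R[G]) : x ^ p ^ k = single 1 (aug R G x ^ p ^ k) := by
  have : CharP R[G] p := charP_of_injective_algebraMap (R := R)
    (by
      intro a b hab
      simpa [coe_algebraMap, single_right_inj] using hab) p
  induction x using MonoidAlgebra.induction_linear with
  | zero => simp [(Nat.Prime.pos Fact.out : 0 < p).ne']
  | add x y hx hy => rw [add_pow_char_pow, hx, hy, map_add, add_pow_char_pow, single_add]
  | single g r => rw [single_pow, hG, aug_single]

theorem isUnit_of_aug_eq_one (p k : ℕ) [Fact p.Prime] [CharP R p] (hG : ∀ g : G, g ^ p ^ k = 1)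
    {x : R[G]} (hx : aug R G x = 1) : IsUnit x := by
  have h := pow_eq_single_aug_pow p k hG x
  rw [hx, one_pow, ← one_def] at h
  exact IsUnit.of_pow_eq_one h (pow_ne_zero _ (Nat.Prime.pos Fact.out : 0 < p).ne')

variable (G) in
/-- The diagonal `G → G × G`. -/
def diag : G →* G × G := (MonoidHom.id G).prod (MonoidHom.id G)

theorem coeff_inl_mul_inr (u : R[G]) (v : R[H]) (g : G) (h : H) :
    (push R (MonoidHom.inl G H) u * push R (MonoidHom.inr G H) v).coeff (g, h) =
      u.coeff g * v.coeff h := by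
  classical
  induction u using MonoidAlgebra.induction_linear with
  | zero => simp
  | add x y hx hy => simp only [map_add, add_mul, coeff_add, Finsupp.add_apply, hx, hy]
  | single a r =>
    induction v using MonoidAlgebra.induction_linear with
    | zero => simp
    | add x y hx hy => simp only [map_add, mul_add, coeff_add, Finsupp.add_apply, hx, hy]
    | single b s =>
      simp only [push_single, MonoidHom.inl_apply, MonoidHom.inr_apply, single_mul_single,
        Prod.mk_mul_mk, one_mul, mul_one, coeff_single, Finsupp.single_apply, Prod.mk.injEq]
      by_cases h1 : a = g <;> by_cases h2 : b = h <;> simp [h1, h2]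

theorem coeff_diag [DecidableEq G] (u : R[G]) (g h : G) :
    (push R (diag G) u).coeff (g, h) = if g = h then u.coeff g else 0 := by
  induction u using MonoidAlgebra.induction_linear with
  | zero => simp
  | add x y hx hy =>
    simp only [map_add, coeff_add, Finsupp.add_apply, hx, hy]
    split_ifs <;> simp
  | single a r =>
    simp only [push_single, diag, MonoidHom.prod_apply, MonoidHom.id_apply, coeff_single,
      Finsupp.single_apply, Prod.mk.injEq]
    by_cases h1 : a = g <;> by_cases h2 : a = h <;> by_cases h3 : g = h <;> simp_all

/-- An element `u` of `R[G]` such that `Δ(u) = u ⊗ u`. -/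
def IsMultiplicative (u : R[G]) : Prop :=
  push R (diag G) u = push R (MonoidHom.inl G G) u * push R (MonoidHom.inr G G) u

/-- Comparing coefficients in `Δ(u) = u ⊗ u` shows that the coefficients of `u` are orthogonal
idempotents; every rigidity statement about group-like elements below rests on this. -/
theorem IsMultiplicative.coeff_mul_coeff [DecidableEq G] {u : R[G]} (hu : IsMultiplicative u)
    (g h : G) : u.coeff g * u.coeff h = if g = h then u.coeff g else 0 := by
  rw [← coeff_inl_mul_inr, ← hu, coeff_diag]

/-- Over a domain, a group-like element of the group algebra is an element of the group. -/
theorem IsMultiplicative.exists_eq_single [IsDomain R] {u : R[G]} (hu : IsMultiplicative u)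
    (h1 : aug R G u = 1) : ∃ g, u = single g 1 := by
  classical
  have hne : ∃ g, u.coeff g ≠ 0 := by
    by_contra! h
    have : u = 0 := by ext g; simpa using h g
    simp [this] at h1
  obtain ⟨g, hg⟩ := hne
  have hg1 : u.coeff g = 1 := by
    have := hu.coeff_mul_coeff g g
    rw [if_pos rfl] at this
    exact mul_left_cancel₀ hg (by rw [this, mul_one])
  refine ⟨g, ?_⟩
  ext h
  by_cases hgh : g = h
  · subst hgh; simp [hg1]
  · have := hu.coeff_mul_coeff g h
    rw [if_neg hgh, hg1, one_mul] at this
    simp [this, hgh]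

/-- A group-like element which is congruent to `1` modulo a square-zero ideal is `1`. -/
theorem IsMultiplicative.eq_one_of_coeff_mem [Fintype G] {u : R[G]} (hu : IsMultiplicative u)
    (h1 : aug R G u = 1) {I : Ideal R} (hI : I ^ 2 = ⊥) (h : ∀ g ≠ 1, u.coeff g ∈ I) : u = 1 := by
  classical
  -- An idempotent lying in a square-zero ideal vanishes.
  have h0 : ∀ g ≠ 1, u.coeff g = 0 := by
    intro g hg
    have := hu.coeff_mul_coeff g g
    rw [if_pos rfl] at this
    have h2 : u.coeff g * u.coeff g ∈ I ^ 2 := by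
      rw [sq]; exact Ideal.mul_mem_mul (h g hg) (h g hg)
    rwa [hI, this, Ideal.mem_bot] at h2
  have h2 : u.coeff 1 = 1 := by
    rw [aug_eq_sum, Finset.sum_eq_single 1 (fun g _ hg => h0 g hg) (by simp)] at h1
    exact h1
  ext g
  by_cases hg : g = 1
  · subst hg; simp [h2]
  · rw [h0 g hg, one_def, coeff_single, Finsupp.single_apply, if_neg (Ne.symm hg)]

theorem isMultiplicative_single (g : G) : IsMultiplicative (single g 1 : R[G]) := by
  simp [IsMultiplicative, diag]

end Basic

/-! ### Twists as elements of `R[G × G]`, coboundaries and symmetry -/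

section Cocycles

variable {R S : Type*} [CommRing R] [CommRing S] {G : Type*} [CommGroup G]

variable (G) in
/-- `(g, h) ↦ (g, g, h)`. -/
def dupLeft : G × G →* G × (G × G) := (MonoidHom.fst G G).prod (MonoidHom.id (G × G))

variable (G) in
/-- `(g, h) ↦ (g, h, h)`. -/
def dupRight : G × G →* G × (G × G) :=
  (MonoidHom.fst G G).prod ((MonoidHom.snd G G).prod (MonoidHom.snd G G))

variable (G) in
/-- `(g, h) ↦ (g, h, 1)`. -/
def inclLeft : G × G →* G × (G × G) :=
  (MonoidHom.fst G G).prod ((MonoidHom.snd G G).prod 1)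

variable (G) in
/-- `(g, h) ↦ (1, g, h)`. -/
def inclRight : G × G →* G × (G × G) := MonoidHom.inr G (G × G)

/-- Twists of the group algebra `R[G]`, as elements of `R[G × G]` (not assumed invertible). -/
structure IsCocycle (J : R[G × G]) : Prop where
  cocycle : push R (dupLeft G) J * push R (inclLeft G) J =
    push R (dupRight G) J * push R (inclRight G) J
  snd_eq_one : push R (MonoidHom.snd G G) J = 1
  fst_eq_one : push R (MonoidHom.fst G G) J = 1

/-- `J = Δ(x) (x ⊗ x)⁻¹`, for `x` of augmentation `1`. -/
structure Splits (J : R[G × G]) (x : R[G]) : Prop where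
  aug_eq_one : aug R G x = 1
  diag_eq : push R (diag G) x =
    J * (push R (MonoidHom.inl G G) x * push R (MonoidHom.inr G G) x)

theorem Splits.coeffMap {J : R[G × G]} {x : R[G]} (h : Splits J x) (φ : R →+* S) :
    Splits (coeffMap (G × G) φ J) (coeffMap G φ x) where
  aug_eq_one := by rw [aug_coeffMap, h.aug_eq_one, map_one]
  diag_eq := by
    rw [← coeffMap_push, h.diag_eq, map_mul, map_mul, coeffMap_push, coeffMap_push]

theorem Splits.mul {I J : R[G × G]} {x y : R[G]} (h : Splits I x) (k : Splits J y) :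
    Splits (I * J) (x * y) where
  aug_eq_one := by rw [map_mul, h.aug_eq_one, k.aug_eq_one, one_mul]
  diag_eq := by rw [map_mul, h.diag_eq, k.diag_eq, map_mul, map_mul]; ring

theorem Splits.one : Splits (1 : R[G × G]) (1 : R[G]) where
  aug_eq_one := map_one _
  diag_eq := by simp only [map_one, mul_one]

theorem Splits.single (g : G) : Splits (1 : R[G × G]) (single g 1) where
  aug_eq_one := aug_single _ _
  diag_eq := by rw [one_mul]; exact isMultiplicative_single g

theorem Splits.inv {I J : R[G × G]} {x y : R[G]} (h : Splits I x) (hIJ : I * J = 1)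
    (hxy : x * y = 1) : Splits J y where
  aug_eq_one := by
    have := congrArg (aug R G) hxy
    rwa [map_mul, h.aug_eq_one, one_mul, map_one] at this
  diag_eq := by
    have key : ∀ f : G →* G × G, push R f x * push R f y = 1 := fun f => by
      rw [← map_mul, hxy, map_one]
    have h1 := key (diag G)
    have h2 := key (MonoidHom.inl G G)
    have h3 := key (MonoidHom.inr G G)
    rw [h.diag_eq] at h1
    calc push R (diag G) y = push R (diag G) y * (I * J) *
        (push R (MonoidHom.inl G G) x * push R (MonoidHom.inl G G) y) *
        (push R (MonoidHom.inr G G) x * push R (MonoidHom.inr G G) y) := by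
          rw [hIJ, h2, h3]; ring
      _ = (I * (push R (MonoidHom.inl G G) x * push R (MonoidHom.inr G G) x) *
          push R (diag G) y) * (J * (push R (MonoidHom.inl G G) y *
          push R (MonoidHom.inr G G) y)) := by ring
      _ = _ := by rw [h1, one_mul]

/-- Two splittings of the same twist differ by a group-like element. -/
theorem Splits.isMultiplicative_of_eq_mul {J : R[G × G]} {x x' u : R[G]} (h : Splits J x)
    (h' : Splits J x') (hx : IsUnit x) (hJ : IsUnit J) (hu : x' = x * u) :
    IsMultiplicative u := by
  have h1 := h'.diag_eq
  rw [hu, map_mul, h.diag_eq, map_mul, map_mul] at h1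
  have h2 : IsUnit (J * (push R (MonoidHom.inl G G) x * push R (MonoidHom.inr G G) x)) :=
    hJ.mul ((hx.map _).mul (hx.map _))
  refine h2.mul_left_cancel ?_
  rw [h1]; ring

theorem Splits.eq_of_splits {I J : R[G × G]} {x : R[G]} (h : Splits I x) (k : Splits J x)
    (hx : IsUnit x) : I = J := by
  have h2 : IsUnit (push R (MonoidHom.inl G G) x * push R (MonoidHom.inr G G) x) :=
    (hx.map _).mul (hx.map _)
  exact h2.mul_right_cancel (h.diag_eq.symm.trans k.diag_eq)

theorem push_one (x : R[G]) {H : Type*} [CommGroup H] :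
    push R (1 : G →* H) x = single 1 (aug R G x) := by
  induction x using MonoidAlgebra.induction_linear with
  | zero => simp
  | add x y hx hy => rw [map_add, hx, hy, map_add, single_add]
  | single g r => rw [push_single, aug_single, MonoidHom.one_apply]

theorem push_id (x : R[G]) : push R (MonoidHom.id G) x = x := by simp [push]

/-- A coboundary is a cocycle. -/
theorem Splits.isCocycle {J : R[G × G]} {x : R[G]} (h : Splits J x) (hx : IsUnit x) :
    IsCocycle J where
  cocycle := by
    have e (f : G × G →* G × (G × G)) := congrArg (push R f) h.diag_eq
    simp only [map_mul, push_push] at e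
    have e1 := e (dupLeft G)
    have e2 := e (inclLeft G)
    have e3 := e (dupRight G)
    have e4 := e (inclRight G)
    have c1 : (dupRight G).comp (diag G) = (dupLeft G).comp (diag G) := rfl
    have c2 : (dupLeft G).comp (MonoidHom.inl G G) = (inclLeft G).comp (diag G) := rfl
    have c3 : (dupRight G).comp (MonoidHom.inr G G) = (inclRight G).comp (diag G) := rfl
    have c4 : (dupRight G).comp (MonoidHom.inl G G) = (inclLeft G).comp (MonoidHom.inl G G) := rfl
    have c5 : (inclRight G).comp (MonoidHom.inl G G) = (inclLeft G).comp (MonoidHom.inr G G) := rfl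
    have c6 : (inclRight G).comp (MonoidHom.inr G G) = (dupLeft G).comp (MonoidHom.inr G G) := rfl
    rw [c2, e2] at e1
    rw [c1, c3, e4, c4, c5, c6, e1] at e3
    have hu (f : G →* G × (G × G)) : IsUnit (push R f x) := hx.map _
    -- The unit cancelled here is `x ⊗ x ⊗ x`: both sides of the cocycle identity become the image
    -- of `x` under the threefold diagonal.
    refine ((hu ((inclLeft G).comp (MonoidHom.inl G G))).mul
      ((hu ((inclLeft G).comp (MonoidHom.inr G G))).mul
        (hu ((dupLeft G).comp (MonoidHom.inr G G))))).mul_right_cancel ?_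
    linear_combination e3
  snd_eq_one := by
    have e := congrArg (push R (MonoidHom.snd G G)) h.diag_eq
    have c1 : (MonoidHom.snd G G).comp (diag G) = MonoidHom.id G := rfl
    simp only [map_mul, push_push, c1, MonoidHom.snd_comp_inl, MonoidHom.snd_comp_inr, push_id,
      push_one, h.aug_eq_one, ← one_def, one_mul] at e
    exact hx.mul_right_cancel (by rw [← e, one_mul])
  fst_eq_one := by
    have e := congrArg (push R (MonoidHom.fst G G)) h.diag_eq
    have c1 : (MonoidHom.fst G G).comp (diag G) = MonoidHom.id G := rfl
    simp only [map_mul, push_push, c1, MonoidHom.fst_comp_inl, MonoidHom.fst_comp_inr, push_id,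
      push_one, h.aug_eq_one, ← one_def, mul_one] at e
    exact hx.mul_right_cancel (by rw [← e, one_mul])

theorem isCocycle_of_coeffMap {φ : R →+* S} (hφ : Function.Injective φ) {J : R[G × G]}
    (h : IsCocycle (TwistCohomology.coeffMap (G × G) φ J)) : IsCocycle J := by
  have inj {H : Type _} [CommGroup H] : Function.Injective (TwistCohomology.coeffMap H φ) := by
    intro x y hxy
    ext g
    have := congrArg (fun z => z.coeff g) hxy
    exact hφ (by simpa using this)
  refine ⟨inj ?_, inj ?_, inj ?_⟩
  · simpa only [map_mul, coeffMap_push] using h.cocycle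
  · rw [coeffMap_push, h.snd_eq_one, map_one]
  · rw [coeffMap_push, h.fst_eq_one, map_one]

variable (G) in
/-- The exchange of the two factors. -/
def swap : G × G →* G × G := (MonoidHom.snd G G).prod (MonoidHom.fst G G)

/-- Treating the first variable as part of the coefficient ring `R[G]` turns doubling of the second
variable into an honest diagonal over `R[G]`. With the two analogues below, multiplicativity in the
second variable becomes `IsMultiplicative` over `R[G]`. -/
theorem curry_push_dupRight (u : R[G × G]) :
    curryRingEquiv (push R ((MulEquiv.prodComm.toMonoidHom.comp (dupRight G))) u) =
      push R[G] (diag G) (curryRingEquiv (push R (swap G) u)) := by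
  induction u using MonoidAlgebra.induction_linear with
  | zero => simp
  | add x y hx hy => simp only [map_add, hx, hy]
  | single g r => simp [swap, diag, dupRight]

/-- `(g, h) ↦ (g, 1, h)`. -/
def inclOuter (G : Type*) [CommGroup G] : G × G →* G × (G × G) :=
  (MonoidHom.fst G G).prod ((1 : G × G →* G).prod (MonoidHom.snd G G))

theorem curry_push_inclLeft (u : R[G × G]) :
    curryRingEquiv (push R ((MulEquiv.prodComm.toMonoidHom.comp (inclLeft G))) u) =
      push R[G] (MonoidHom.inl G G) (curryRingEquiv (push R (swap G) u)) := by
  induction u using MonoidAlgebra.induction_linear with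
  | zero => simp
  | add x y hx hy => simp only [map_add, hx, hy]
  | single g r => simp [swap, inclLeft]

theorem curry_push_inclOuter (u : R[G × G]) :
    curryRingEquiv (push R ((MulEquiv.prodComm.toMonoidHom.comp (inclOuter G))) u) =
      push R[G] (MonoidHom.inr G G) (curryRingEquiv (push R (swap G) u)) := by
  induction u using MonoidAlgebra.induction_linear with
  | zero => simp
  | add x y hx hy => simp only [map_add, hx, hy]
  | single g r => simp [swap, inclOuter]

theorem coeffMap_aug_curry (u : R[G × G]) :
    TwistCohomology.coeffMap G (aug R G).toRingHom (curryRingEquiv u) =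
      push R (MonoidHom.fst G G) u := by
  induction u using MonoidAlgebra.induction_linear with
  | zero => simp
  | add x y hx hy => simp only [map_add, hx, hy]
  | single g r =>
    obtain ⟨a, b⟩ := g
    rw [curryRingEquiv_single, mapRingHom_single, push_single, MonoidHom.coe_fst]
    exact congrArg _ (aug_single b r)

/-- If `G` is a finite abelian `p`-group and `R` is a field of characteristic `p`, there are no
nontrivial elements of `R[G × G]` which are multiplicative in the second variable. -/
theorem eq_one_of_multiplicative_snd (p k : ℕ) [Fact p.Prime] [CharP R p]
    (hG : ∀ g : G, g ^ p ^ k = 1) {u : R[G × G]}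
    (hu : push R (dupRight G) u = push R (inclLeft G) u * push R (inclOuter G) u)
    (h2 : push R (MonoidHom.snd G G) u = 1) : u = 1 := by
  classical
  set v : R[G][G] := curryRingEquiv (push R (swap G) u) with hv
  have hm : IsMultiplicative v := by
    have := congrArg (fun z => curryRingEquiv (push R
      (MulEquiv.prodComm : G × (G × G) ≃* (G × G) × G).toMonoidHom z)) hu
    simp only [map_mul, push_push, curry_push_dupRight, curry_push_inclLeft,
      curry_push_inclOuter] at this
    exact this
  have hc : TwistCohomology.coeffMap G (aug R G).toRingHom v = 1 := by
    rw [hv, coeffMap_aug_curry, push_push]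
    exact h2
  have hv1 : v = 1 := by
    ext1
    ext1 g
    have hid := hm.coeff_mul_coeff g g
    rw [if_pos rfl] at hid
    -- Each coefficient is an idempotent of `R[G]`, so it equals its `p ^ k`-th power, which is a
    -- scalar determined by the augmentation; the augmentations are known from `hc`.
    have hpow : v.coeff g ^ p ^ k = v.coeff g :=
      IsIdempotentElem.pow_eq hid (pow_ne_zero _ (Nat.Prime.pos Fact.out : 0 < p).ne')
    have hg := congrArg (fun z => z.coeff g) hc
    simp only [coeff_mapRingHom] at hg
    rw [pow_eq_single_aug_pow p k hG] at hpow
    rw [← hpow]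
    have hg' : aug R G (v.coeff g) = (1 : R[G]).coeff g := hg
    rw [hg', one_def, one_def, coeff_single, coeff_single, Finsupp.single_apply,
      Finsupp.single_apply]
    split_ifs
    · rw [one_pow, one_def]
    · rw [zero_pow (pow_ne_zero _ (Nat.Prime.pos Fact.out : 0 < p).ne'), single_zero]
  have hs : push R (swap G) u = 1 := by
    rw [hv] at hv1
    exact (map_eq_one_iff _ curryRingEquiv.injective).1 hv1
  have := congrArg (push R (swap G)) hs
  rw [push_push, map_one] at this
  rwa [show (swap G).comp (swap G) = MonoidHom.id _ from rfl, push_id] at this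

/-- Twists for a finite abelian `p`-group in characteristic `p` are symmetric. -/
theorem IsCocycle.push_swap (p k : ℕ) [Fact p.Prime] [CharP R p] (hG : ∀ g : G, g ^ p ^ k = 1)
    {J : R[G × G]} (hJ : IsCocycle J) (hu : IsUnit J) : push R (swap G) J = J := by
  obtain ⟨I, hI⟩ := hu.exists_right_inv
  suffices h : J * push R (swap G) I = 1 by
    have h2 : push R (swap G) J * push R (swap G) I = 1 := by rw [← map_mul, hI, map_one]
    calc push R (swap G) J = push R (swap G) J * (J * push R (swap G) I) := by rw [h, mul_one]
      _ = J * (push R (swap G) J * push R (swap G) I) := by ring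
      _ = J := by rw [h2, mul_one]
  have inv (f : G × G →* G × (G × G)) : push R f J * push R f I = 1 := by
    rw [← map_mul, hI, map_one]
  have inv' (f : G × G →* G) : push R f J * push R f I = 1 := by
    rw [← map_mul, hI, map_one]
  -- The quotient of `J` by its flip plays the role of the alternating bicharacter of a 2-cocycle.
  refine eq_one_of_multiplicative_snd p k hG ?_ ?_
  · simp only [map_mul, push_push]
    have e (f : G × (G × G) →* G × (G × G)) := congrArg (push R f) hJ.cocycle
    simp only [map_mul, push_push] at e
    have e1 := hJ.cocycle
    let π₁ : G × (G × G) →* G := MonoidHom.fst G (G × G)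
    let π₂ : G × (G × G) →* G := (MonoidHom.fst G G).comp (MonoidHom.snd G (G × G))
    let π₃ : G × (G × G) →* G := (MonoidHom.snd G G).comp (MonoidHom.snd G (G × G))
    -- Multiplicativity in the second variable combines the cocycle identity with its images under
    -- the permutations `(a, b, c) ↦ (c, a, b)` and `(a, b, c) ↦ (b, a, c)`.
    let r : G × (G × G) →* G × (G × G) := π₃.prod (π₁.prod π₂)
    let s : G × (G × G) →* G × (G × G) := π₂.prod (π₁.prod π₃)
    have e2 := e r
    have e3 := e s
    have c1 : r.comp (dupLeft G) = (dupRight G).comp (swap G) := rfl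
    have c2 : r.comp (inclLeft G) = inclRight G := rfl
    have c3 : r.comp (dupRight G) = s.comp (dupRight G) := rfl
    have c4 : r.comp (inclRight G) = (inclOuter G).comp (swap G) := rfl
    have c5 : s.comp (dupLeft G) = dupLeft G := rfl
    have c6 : s.comp (inclLeft G) = (inclLeft G).comp (swap G) := rfl
    have c7 : s.comp (inclRight G) = inclOuter G := rfl
    rw [c1, c2, c3, c4] at e2
    rw [c5, c6, c7] at e3
    have i1 := inv ((dupRight G).comp (swap G))
    have i2 := inv ((inclLeft G).comp (swap G))
    have i3 := inv ((inclOuter G).comp (swap G))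
    -- After multiplication by the unit `1 ⊗ J`, only an identity in a commutative ring remains,
    -- implied by `e1`, `e2`, `e3` and the inverse relations.
    refine (hu.map (push R (inclRight G))).mul_left_cancel ?_
    generalize push R ((dupRight G).comp (swap G)) I = e' at *
    generalize push R ((inclLeft G).comp (swap G)) I = b' at *
    generalize push R ((inclOuter G).comp (swap G)) I = h' at *
    generalize push R ((dupRight G).comp (swap G)) J = e at *
    generalize push R ((inclLeft G).comp (swap G)) J = b₁ at *
    generalize push R ((inclOuter G).comp (swap G)) J = h at *
    generalize push R (s.comp (dupRight G)) J = f at *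
    generalize push R (dupLeft G) J = a at *
    generalize push R (inclLeft G) J = b at *
    generalize push R (dupRight G) J = c at *
    generalize push R (inclRight G) J = d at *
    generalize push R (inclOuter G) J = o at *
    calc d * (c * e') = (a * b₁) * b * h * (e' * b' * h') := by
          linear_combination (-e' * b₁ * b' * h * h') * e1 + (-d * c * e') * (i2 * h * h' + i3)
      _ = b * o * (e * d) * (e' * b' * h') := by
          linear_combination (b * h * e' * b' * h') * e3 - (b * o * e' * b' * h') * e2
      _ = d * (b * b' * (o * h')) := by linear_combination (b * o * d * b' * h') * i1
  · rw [map_mul, push_push, hJ.snd_eq_one, one_mul,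
      show (MonoidHom.snd G G).comp (swap G) = MonoidHom.fst G G from rfl]
    simpa [hJ.fst_eq_one] using inv' (MonoidHom.fst G G)

end Cocycles

/-! ### Pairing group algebra elements with functions -/

section Pairing

variable {R : Type*} [CommRing R] {G H N : Type*} [CommGroup G] [CommGroup H] [CommGroup N]
  [Fintype G] [Fintype H] [Fintype N]

/-- The linear extension of a function on `G` to the group algebra. -/
def pairing (u : R[G]) (F : G → R) : R := ∑ g, u.coeff g * F g

theorem pairing_push_mul_push (f : G →* N) (f' : H →* N) (u : R[G]) (v : R[H]) (F : N → R) :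
    pairing (push R f u * push R f' v) F =
      ∑ g, u.coeff g * ∑ h, v.coeff h * F (f g * f' h) := by
  classical
  unfold pairing
  induction u using MonoidAlgebra.induction_linear with
  | zero => simp
  | add x y hx hy =>
    simp only [map_add, add_mul, coeff_add, Finsupp.add_apply, hx, hy, Finset.sum_add_distrib]
  | single a r =>
    induction v using MonoidAlgebra.induction_linear with
    | zero => simp
    | add x y hx hy =>
      simp only [map_add, add_mul, mul_add, coeff_add, Finsupp.add_apply, hx, hy,
        Finset.sum_add_distrib]
    | single b s =>
      simp [Finsupp.single_apply, mul_assoc]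

theorem pairing_push (f : G →* N) (u : R[G]) (F : N → R) :
    pairing (push R f u) F = ∑ g, u.coeff g * F (f g) := by
  classical
  unfold pairing
  induction u using MonoidAlgebra.induction_linear with
  | zero => simp
  | add x y hx hy =>
    simp only [map_add, add_mul, coeff_add, Finsupp.add_apply, hx, hy, Finset.sum_add_distrib]
  | single a r => simp [Finsupp.single_apply]

theorem pairing_one (F : G → R) : pairing (1 : R[G]) F = F 1 := by
  classical
  simp [pairing, one_def, Finsupp.single_apply]

end Pairing

/-! ### The twisted function algebra and its points -/

/-- The algebra of functions on `G`, with its multiplication twisted by a symmetric twist `J`: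
an étale algebra over which `J` splits. -/
@[nolint unusedArguments]
def TwistedFun {R G : Type*} [CommRing R] [CommGroup G] {J : R[G × G]} (_ : IsCocycle J)
    (_ : push R (swap G) J = J) : Type _ := G → R

namespace TwistedFun

variable {R G : Type*} [CommRing R] [CommGroup G] [Fintype G] {J : R[G × G]} (hJ : IsCocycle J)
  (hs : push R (swap G) J = J)

instance : AddCommGroup (TwistedFun hJ hs) := inferInstanceAs (AddCommGroup (G → R))
instance : Module R (TwistedFun hJ hs) := inferInstanceAs (Module R (G → R))
instance [Nontrivial R] : Nontrivial (TwistedFun hJ hs) := inferInstanceAs (Nontrivial (G → R))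
instance : Module.Finite R (TwistedFun hJ hs) := inferInstanceAs (Module.Finite R (G → R))

instance : Mul (TwistedFun hJ hs) where
  mul f f' := fun a => ∑ s : G × G, J.coeff s * (f (a * s.1) * f' (a * s.2))

instance : One (TwistedFun hJ hs) where
  one := fun _ => 1

theorem mul_apply (f f' : TwistedFun hJ hs) (a : G) :
    (f * f') a = ∑ s : G × G, J.coeff s * (f (a * s.1) * f' (a * s.2)) := rfl

omit [Fintype G] in
theorem one_apply (a : G) : (1 : TwistedFun hJ hs) a = 1 := rfl

omit [Fintype G] in
theorem add_apply (f f' : TwistedFun hJ hs) (a : G) : (f + f') a = f a + f' a := rfl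

omit [Fintype G] in
theorem smul_apply (r : R) (f : TwistedFun hJ hs) (a : G) : (r • f) a = r * f a := rfl

/-- Commutativity is the symmetry of `J`, just as the unit law below is its counit condition. -/
theorem mul_comm' (f f' : TwistedFun hJ hs) : f * f' = f' * f := by
  funext a
  have := pairing_push (swap G) J (fun s => f (a * s.1) * f' (a * s.2))
  rw [hs] at this
  rw [mul_apply, mul_apply]
  refine Eq.trans this (Finset.sum_congr rfl fun s _ => ?_)
  simp [swap, mul_comm]

theorem one_mul' (f : TwistedFun hJ hs) : 1 * f = f := by
  funext a
  have := pairing_push (MonoidHom.snd G G) J (fun s => f (a * s))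
  rw [hJ.snd_eq_one, pairing_one, mul_one] at this
  rw [this, mul_apply]
  simp [one_apply]

/-- The two bracketings are the pairings of the two sides of the cocycle identity with one function
of three variables. -/
theorem mul_assoc' (f f' f'' : TwistedFun hJ hs) : f * f' * f'' = f * (f' * f'') := by
  funext a
  have h1 := pairing_push_mul_push (dupLeft G) (inclLeft G) J J
    (fun s => f (a * s.1) * f' (a * s.2.1) * f'' (a * s.2.2))
  have h2 := pairing_push_mul_push (dupRight G) (inclRight G) J J
    (fun s => f (a * s.1) * f' (a * s.2.1) * f'' (a * s.2.2))
  rw [hJ.cocycle, h2] at h1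
  simp only [mul_apply, Finset.sum_mul, Finset.mul_sum] at h1 ⊢
  convert h1.symm using 4 with s _ t _ s _ t _
  · simp [dupLeft, inclLeft, mul_assoc]
  · simp [dupRight, inclRight, mul_assoc]; ring

instance : CommRing (TwistedFun hJ hs) where
  left_distrib f g h := by
    funext a
    simp only [mul_apply, add_apply, mul_add, Finset.sum_add_distrib]
  right_distrib f g h := by
    funext a
    simp only [mul_apply, add_apply, mul_add, add_mul, Finset.sum_add_distrib]
  zero_mul f := by
    funext a
    rw [mul_apply]
    refine Finset.sum_eq_zero fun s _ => ?_
    rw [show (0 : TwistedFun hJ hs) (a * s.1) = 0 from rfl, zero_mul, mul_zero]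
  mul_zero f := by
    funext a
    rw [mul_apply]
    refine Finset.sum_eq_zero fun s _ => ?_
    rw [show (0 : TwistedFun hJ hs) (a * s.2) = 0 from rfl, mul_zero, mul_zero]
  mul_assoc := mul_assoc' hJ hs
  one_mul := one_mul' hJ hs
  mul_one f := by rw [mul_comm', one_mul']
  mul_comm := mul_comm' hJ hs
  neg_add_cancel := neg_add_cancel
  sub_eq_add_neg := SubNegMonoid.sub_eq_add_neg
  zsmul := (· • ·)
  zsmul_zero' := SubNegMonoid.zsmul_zero'
  zsmul_succ' := SubNegMonoid.zsmul_succ'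
  zsmul_neg' := SubNegMonoid.zsmul_neg'

theorem smul_mul' (r : R) (f f' : TwistedFun hJ hs) : r • f * f' = r • (f * f') := by
  funext a
  simp only [mul_apply, smul_apply, Finset.mul_sum]
  exact Finset.sum_congr rfl fun s _ => by ring

instance : Algebra R (TwistedFun hJ hs) :=
  Algebra.ofModule (smul_mul' hJ hs) fun r f f' => by
    rw [mul_comm, smul_mul', mul_comm]

/-- The indicator function of `g`. -/
noncomputable def delta [DecidableEq G] (g : G) : TwistedFun hJ hs := fun h => if h = g then 1 else 0

theorem eq_sum_delta [DecidableEq G] (f : TwistedFun hJ hs) : f = ∑ g, f g • delta hJ hs g := by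
  refine (pi_eq_sum_univ f).trans (Finset.sum_congr rfl fun g _ => ?_)
  funext h
  change f g * (if g = h then 1 else 0) = f g * (if h = g then 1 else 0)
  simp only [eq_comm]

variable {B : Type*} [CommRing B] [Algebra R B]

/-- The point of the group algebra defined by an algebra homomorphism from the twisted function
algebra. -/
noncomputable def point [DecidableEq G] (φ : TwistedFun hJ hs →ₐ[R] B) : B[G] :=
  ofCoeff (Finsupp.equivFunOnFinite.symm fun g => φ (delta hJ hs g))

variable {hJ hs}

theorem coeff_point [DecidableEq G] (φ : TwistedFun hJ hs →ₐ[R] B) (g : G) :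
    (point hJ hs φ).coeff g = φ (delta hJ hs g) := rfl

/-- The coefficients at `(g, h)` agree because `φ` is multiplicative on `delta g * delta h`, whose
expansion in indicator functions has coefficients read off from `J`. The equation is that of a
splitting with `x` replaced by its inverse. -/
theorem splits_point [DecidableEq G] (φ : TwistedFun hJ hs →ₐ[R] B) :
    coeffMap (G × G) (algebraMap R B) J * push B (diag G) (point hJ hs φ) =
      push B (MonoidHom.inl G G) (point hJ hs φ) * push B (MonoidHom.inr G G) (point hJ hs φ) := by
  ext ⟨g, h⟩
  rw [coeff_inl_mul_inr, coeff_point, coeff_point, ← map_mul,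
    eq_sum_delta hJ hs (delta hJ hs g * delta hJ hs h)]
  have key := pairing_push_mul_push (MonoidHom.id (G × G)) (diag G)
    (coeffMap (G × G) (algebraMap R B) J) (point hJ hs φ) (fun s => if s = (g, h) then 1 else 0)
  rw [push_id] at key
  simp only [pairing, mul_ite, mul_one, mul_zero, Finset.sum_ite_eq', Finset.mem_univ, if_true]
    at key
  rw [key]
  simp only [map_sum, map_smul]
  simp only [mul_apply, Algebra.smul_def, map_sum, Finset.sum_mul, Finset.mul_sum,
    coeff_mapRingHom, coeff_point]
  rw [Finset.sum_comm]
  refine Finset.sum_congr rfl fun a _ => Finset.sum_congr rfl fun s _ => ?_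
  rw [map_mul (algebraMap R B), mul_assoc]
  congr 1
  simp only [delta, diag, MonoidHom.id_apply, MonoidHom.prod_apply, Prod.ext_iff, Prod.fst_mul,
    Prod.snd_mul, mul_comm s.1 a, mul_comm s.2 a]
  split_ifs <;> simp_all

theorem aug_point [DecidableEq G] (φ : TwistedFun hJ hs →ₐ[R] B) : aug B G (point hJ hs φ) = 1 := by
  rw [aug_eq_sum]
  simp only [coeff_point]
  rw [← map_sum, ← map_one φ, eq_sum_delta hJ hs 1]
  simp [one_apply]

/-- The inverse of a point of the twisted function algebra splits the twist. -/
theorem splits_of_mul_point [DecidableEq G] (φ : TwistedFun hJ hs →ₐ[R] B) {x : B[G]}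
    (hx : point hJ hs φ * x = 1) : Splits (coeffMap (G × G) (algebraMap R B) J) x where
  aug_eq_one := by
    have := congrArg (aug B G) hx
    rwa [map_mul, aug_point, one_mul, map_one] at this
  diag_eq := by
    have key : ∀ f : G →* G × G, push B f (point hJ hs φ) * push B f x = 1 := fun f => by
      rw [← map_mul, hx, map_one]
    have h1 := key (diag G)
    have h2 := key (MonoidHom.inl G G)
    have h3 := key (MonoidHom.inr G G)
    have h4 := splits_point φ
    generalize push B (MonoidHom.inl G G) (point hJ hs φ) = p at *
    generalize push B (MonoidHom.inr G G) (point hJ hs φ) = q at *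
    generalize push B (MonoidHom.inl G G) x = p' at *
    generalize push B (MonoidHom.inr G G) x = q' at *
    linear_combination (-push B (diag G) x * q * q') * h2 - push B (diag G) x * h3 -
      push B (diag G) x * p' * q' * h4 + coeffMap (G × G) (algebraMap R B) J * p' * q' * h1

theorem algHom_ext_of_point_eq [DecidableEq G] {φ ψ : TwistedFun hJ hs →ₐ[R] B}
    (h : point hJ hs φ = point hJ hs ψ) : φ = ψ := by
  ext f
  rw [eq_sum_delta hJ hs f, map_sum, map_sum]
  refine Finset.sum_congr rfl fun g _ => ?_
  rw [map_smul, map_smul, ← coeff_point, ← coeff_point, h]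

end TwistedFun

/-! ### Splitting of twists over separably closed fields -/

section Field

variable {K : Type*} [Field K] {G : Type*} [CommGroup G] [Fintype G] {J : K[G × G]}
  {hJ : IsCocycle J} {hs : push K (swap G) J = J}

theorem TwistedFun.exists_mul_point_eq_one [DecidableEq G] (p k : ℕ) [Fact p.Prime] [CharP K p]
    (hG : ∀ g : G, g ^ p ^ k = 1) {B : Type*} [CommRing B] [Nontrivial B] [Algebra K B]
    (φ : TwistedFun hJ hs →ₐ[K] B) : ∃ x : B[G], point hJ hs φ * x = 1 :=
  have : CharP B p := charP_of_injective_algebraMap (algebraMap K B).injective p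
  (isUnit_of_aug_eq_one p k hG (aug_point φ)).exists_right_inv

/-- Two points that agree modulo a square-zero ideal have a group-like quotient congruent to `1`,
and such a group-like element is `1`. -/
theorem TwistedFun.formallyUnramified (p k : ℕ) [Fact p.Prime] [CharP K p]
    (hG : ∀ g : G, g ^ p ^ k = 1) (hu : IsUnit J) :
    Algebra.FormallyUnramified K (TwistedFun hJ hs) := by
  classical
  rw [Algebra.FormallyUnramified.iff_comp_injective]
  intro B _ _ I hI φ ψ h
  rcases subsingleton_or_nontrivial B with hB | hB
  · exact AlgHom.ext fun _ => Subsingleton.elim _ _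
  obtain ⟨x, hx⟩ := exists_mul_point_eq_one p k hG φ
  obtain ⟨y, hy⟩ := exists_mul_point_eq_one p k hG ψ
  have hxs := splits_of_mul_point φ hx
  have hys := splits_of_mul_point ψ hy
  have hm : IsMultiplicative (point hJ hs φ * y) :=
    hxs.isMultiplicative_of_eq_mul hys (IsUnit.of_mul_eq_one_right _ hx) (hu.map _)
      (by rw [← mul_assoc, mul_comm x, hx, one_mul])
  have hp : coeffMap G (Ideal.Quotient.mk I) (point hJ hs φ) =
      coeffMap G (Ideal.Quotient.mk I) (point hJ hs ψ) := by
    ext g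
    simp only [coeff_mapRingHom, coeff_point]
    exact DFunLike.congr_fun h (delta hJ hs g)
  have h1 : point hJ hs φ * y = 1 := by
    refine hm.eq_one_of_coeff_mem ?_ hI fun g hg => ?_
    · rw [map_mul, hys.aug_eq_one, aug_point, mul_one]
    · have h2 : coeffMap G (Ideal.Quotient.mk I) (point hJ hs φ * y) = 1 := by
        rw [map_mul, hp, ← map_mul, hy, map_one]
      have h3 := congrArg (fun z => z.coeff g) h2
      simp only [coeff_mapRingHom] at h3
      rw [one_def, coeff_single, Finsupp.single_apply, if_neg (Ne.symm hg)] at h3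
      exact Ideal.Quotient.eq_zero_iff_mem.1 h3
  refine algHom_ext_of_point_eq ?_
  calc point hJ hs φ = point hJ hs φ * (point hJ hs ψ * y) := by rw [hy, mul_one]
    _ = point hJ hs φ * y * point hJ hs ψ := by ring
    _ = point hJ hs ψ := by rw [h1, one_mul]

/-- Twists for finite abelian `p`-groups in characteristic `p` split over separably closed
fields. -/
theorem IsCocycle.exists_splits (p k : ℕ) [Fact p.Prime] [CharP K p]
    (hG : ∀ g : G, g ^ p ^ k = 1) (hJ : IsCocycle J) (hu : IsUnit J) (L : Type*) [Field L]
    [Algebra K L] [IsSepClosed L] : ∃ x : L[G], Splits (coeffMap (G × G) (algebraMap K L) J) x := by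
  classical
  have hs := hJ.push_swap p k hG hu
  have := TwistedFun.formallyUnramified (hJ := hJ) (hs := hs) p k hG hu
  -- The residue field at any maximal ideal is separable over `K`, hence embeds into `L` and
  -- supplies a point.
  obtain ⟨m, hm⟩ := Ideal.exists_maximal (TwistedFun hJ hs)
  let M := TwistedFun hJ hs ⧸ m
  let _ : Field M := Ideal.Quotient.field m
  have : Algebra.FormallyUnramified K M :=
    Algebra.FormallyUnramified.of_surjective (Ideal.Quotient.mkₐ K m)
      (Ideal.Quotient.mkₐ_surjective K m)
  have : Algebra.IsSeparable K M := Algebra.FormallyUnramified.isSeparable K M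
  let φ : TwistedFun hJ hs →ₐ[K] L :=
    (IsSepClosed.lift : M →ₐ[K] L).comp (Ideal.Quotient.mkₐ K m)
  obtain ⟨x, hx⟩ := TwistedFun.exists_mul_point_eq_one p k hG φ
  exact ⟨x, TwistedFun.splits_of_mul_point φ hx⟩

end Field

/-! ### Truncated Witt vectors and the kernel and image of `F - 1` -/

section Witt

variable {p : ℕ} (n : ℕ) [Fact p.Prime] {R S T : Type*} [CommRing R] [CommRing S] [CommRing T]

theorem truncate_map_eq (f : R →+* S) {x y : WittVector p R}
    (h : WittVector.truncate n x = WittVector.truncate n y) :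
    WittVector.truncate n (WittVector.map f x) = WittVector.truncate n (WittVector.map f y) := by
  ext i
  have := congrArg (fun z => TruncatedWittVector.coeff i z) h
  simp only [WittVector.coeff_truncate] at this
  simp [this]

/-- Functoriality of truncated Witt vectors. -/
noncomputable def wittMap (f : R →+* S) : TruncatedWittVector p n R →+* TruncatedWittVector p n S :=
  RingHom.liftOfSurjective (WittVector.truncate n) (WittVector.truncate_surjective p n R)
    ⟨(WittVector.truncate n).comp (WittVector.map f), fun x hx => by
      rw [RingHom.mem_ker, ← map_zero (WittVector.truncate n)] at hx
      have := truncate_map_eq n f hx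
      rwa [map_zero, map_zero] at this⟩

theorem wittMap_truncate (f : R →+* S) (x : WittVector p R) :
    wittMap n f (WittVector.truncate n x) = WittVector.truncate n (WittVector.map f x) :=
  RingHom.liftOfRightInverse_comp_apply _ _ _ _ _

variable {n}

@[simp]
theorem coeff_wittMap (f : R →+* S) (x : TruncatedWittVector p n R) (i : Fin n) :
    (wittMap n f x).coeff i = f (x.coeff i) := by
  obtain ⟨x, rfl⟩ := WittVector.truncate_surjective p n R x
  rw [wittMap_truncate, WittVector.coeff_truncate, WittVector.coeff_truncate, WittVector.map_coeff]

theorem wittMap_injective {f : R →+* S} (hf : Function.Injective f) :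
    Function.Injective (wittMap (p := p) n f) := by
  intro x y hxy
  ext i
  have := congrArg (fun z => TruncatedWittVector.coeff i z) hxy
  simp only [coeff_wittMap] at this
  exact hf this

variable [CharP R p] [CharP S p]

theorem coeff_wittFrobenius (x : TruncatedWittVector p n R) (i : Fin n) :
    (wittFrobenius p n R x).coeff i = x.coeff i ^ p := by
  simp [wittFrobenius, wittFrobeniusFun]

theorem wittP_apply (x : TruncatedWittVector p n R) : wittP p n R x = wittFrobenius p n R x - x :=
  rfl

theorem wittP_truncate (x : WittVector p R) :
    wittP p n R (WittVector.truncate n x) =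
      WittVector.truncate n (WittVector.frobenius x - x) := by
  rw [wittP_apply, map_sub]
  exact congrArg (· - _) (wittFrobeniusFun_truncate p n R x)

theorem wittMap_wittP (f : R →+* S) (x : TruncatedWittVector p n R) :
    wittMap n f (wittP p n R x) = wittP p n S (wittMap n f x) := by
  rw [wittP_apply, wittP_apply, map_sub]
  congr 1
  ext i
  simp [coeff_wittFrobenius]

variable (p n R) in
/-- The prime ring `ℤ/pⁿℤ = W_n(𝔽_p)` of `W_n(R)`. -/
noncomputable def constHom : ZMod (p ^ n) →+* TruncatedWittVector p n R :=
  (wittMap n (ZMod.castHom dvd_rfl R)).comp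
    (TruncatedWittVector.zmodEquivTrunc p n : ZMod (p ^ n) →+* TruncatedWittVector p n (ZMod p))

theorem constHom_injective [Nontrivial R] : Function.Injective (constHom p n R) :=
  (wittMap_injective (ZMod.castHom_injective R)).comp
    (TruncatedWittVector.zmodEquivTrunc p n).injective

theorem wittMap_constHom (f : R →+* S) (k : ZMod (p ^ n)) :
    wittMap n f (constHom p n R k) = constHom p n S k :=
  DFunLike.congr_fun (RingHom.ext_zmod ((wittMap n f).comp (constHom p n R)) (constHom p n S)) k

/-- By functoriality this reduces to `W_n(𝔽_p)`, where `F` is the identity since `a ^ p = a`. -/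
theorem wittP_constHom (k : ZMod (p ^ n)) : wittP p n R (constHom p n R k) = 0 := by
  rw [constHom, RingHom.comp_apply, ← wittMap_wittP]
  rw [wittP_apply]
  convert map_zero (wittMap (p := p) n (ZMod.castHom dvd_rfl R))
  rw [sub_eq_zero]
  ext i
  rw [coeff_wittFrobenius, ZMod.pow_card]

/-- The kernel of `F - 1` on `W_n(L)`, for a field `L`, is `W_n(𝔽_p) = ℤ/pⁿℤ`. -/
theorem exists_constHom_eq {L : Type*} [Field L] [CharP L p] {y : TruncatedWittVector p n L}
    (hy : wittP p n L y = 0) : ∃ k, constHom p n L k = y := by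
  have h (i : Fin n) : ∃ a : ZMod p, ZMod.castHom dvd_rfl L a = y.coeff i := by
    rw [wittP_apply, sub_eq_zero] at hy
    have := congrArg (fun z => TruncatedWittVector.coeff i z) hy
    simp only [coeff_wittFrobenius] at this
    obtain ⟨m, hm⟩ := (mem_bot_iff_intCast p L).1
      ((Subfield.mem_bot_iff_pow_eq_self L p).2 this)
    exact ⟨m, by rw [map_intCast, hm]⟩
  choose a ha using h
  refine ⟨(TruncatedWittVector.zmodEquivTrunc p n).symm (TruncatedWittVector.mk p a), ?_⟩
  ext i
  simp [constHom, ← ha]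

/-- An Artin-Schreier equation solves the zeroth coefficient through a Teichmüller lift. The error
is a Verschiebung `V(w')`, and since `F` commutes with `V` the same problem recurs for `w'` with one
coefficient fewer. -/
theorem exists_wittP_eq {L : Type*} [Field L] [CharP L p] [IsSepClosed L]
    (w : TruncatedWittVector p n L) : ∃ y, wittP p n L y = w := by
  have hsol (c : L) : ∃ a : L, a ^ p - a = c := by
    -- `X ^ p - X - c` is separable, its derivative being `-1` in characteristic `p`.
    obtain ⟨a, ha⟩ := IsSepClosed.exists_root_C_mul_X_pow_add_C_mul_X_add_C' p p (1 : L) (-1) (-c)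
      dvd_rfl (Nat.Prime.two_le Fact.out) (by simp)
    exact ⟨a, by linear_combination ha⟩
  suffices h : ∀ (n : ℕ) (w : WittVector p L), ∃ y : WittVector p L,
      ∀ i < n, (WittVector.frobenius y - y - w).coeff i = 0 by
    obtain ⟨w, rfl⟩ := WittVector.truncate_surjective p n L w
    obtain ⟨y, hy⟩ := h n w
    refine ⟨WittVector.truncate n y, ?_⟩
    rw [wittP_truncate, ← sub_eq_zero, ← map_sub, ← RingHom.mem_ker, WittVector.mem_ker_truncate]
    exact hy
  intro n
  induction n with
  | zero => exact fun w => ⟨0, by simp⟩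
  | succ n ih =>
    intro w
    obtain ⟨a, ha⟩ := hsol (w.coeff 0)
    set t := WittVector.teichmuller p a
    obtain ⟨w', hw'⟩ : ∃ w', WittVector.frobenius t - t - w = WittVector.verschiebung w' := by
      refine ⟨WittVector.shift _ 1, WittVector.eq_iterate_verschiebung (n := 1) fun i hi => ?_⟩
      obtain rfl : i = 0 := by omega
      rw [← WittVector.constantCoeff_apply]
      rw [map_sub, map_sub]
      simp only [WittVector.constantCoeff_apply, WittVector.coeff_frobenius_charP, t,
        WittVector.teichmuller_coeff_zero, ha, sub_self]
    obtain ⟨y, hy⟩ := ih (-w')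
    refine ⟨t + WittVector.verschiebung y, ?_⟩
    have : WittVector.frobenius (t + WittVector.verschiebung y) - (t + WittVector.verschiebung y) -
        w = WittVector.verschiebung (WittVector.frobenius y - y - -w') := by
      have h1 : WittVector.frobenius (WittVector.verschiebung y) =
        WittVector.verschiebung (WittVector.frobenius y) := by
        rw [WittVector.frobenius_verschiebung, WittVector.verschiebung_frobenius]
      rw [map_add, h1, map_sub, map_sub, map_neg, ← hw']
      ring
    rw [this]
    rintro (_ | i) hi
    · rfl
    · rw [WittVector.verschiebung_coeff_succ]
      exact hy i (by omega)

theorem isUnit_truncate {L : Type*} [Field L] [CharP L p] {x : WittVector p L}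
    (hx : x.coeff 0 ≠ 0) : IsUnit (WittVector.truncate n x) :=
  (WittVector.isUnit_of_coeff_zero_ne_zero x hx).map _

end Witt

/-! ### Galois descent for coefficients -/

section Descent

variable {K L : Type*} [Field K] [Field L] [Algebra K L]

/-- The action of the Galois group on the coefficients of a group algebra. -/
noncomputable abbrev galCoeff (G : Type*) [CommGroup G] (σ : L ≃ₐ[K] L) : L[G] →+* L[G] :=
  coeffMap G (σ : L →+* L)

theorem galCoeff_coeffMap {G : Type*} [CommGroup G] (σ : L ≃ₐ[K] L) (x : K[G]) :
    galCoeff G σ (coeffMap G (algebraMap K L) x) = coeffMap G (algebraMap K L) x := by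
  ext g; simp

theorem coeffMap_algebraMap_injective {G : Type*} [CommGroup G] :
    Function.Injective (coeffMap G (algebraMap K L)) := by
  intro x y hxy
  ext g
  have := congrArg (fun z => z.coeff g) hxy
  simpa using this

theorem exists_coeffMap_eq [IsGalois K L] {G : Type*} [CommGroup G] {x : L[G]}
    (hx : ∀ σ : L ≃ₐ[K] L, galCoeff G σ x = x) : ∃ y : K[G], coeffMap G (algebraMap K L) y = x := by
  have h (g : G) : ∃ a : K, algebraMap K L a = x.coeff g := by
    refine (InfiniteGalois.mem_range_algebraMap_iff_fixed _).2 fun σ => ?_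
    have := congrArg (fun z => z.coeff g) (hx σ)
    simpa using this
  choose a ha using h
  refine ⟨ofCoeff (Finsupp.onFinset x.coeff.support a fun g hg => ?_), ?_⟩
  · rw [Finsupp.mem_support_iff, ← ha]
    simpa using hg
  · ext g
    simp [ha]

variable {p n : ℕ} [Fact p.Prime]

/-- The action of the Galois group on truncated Witt vectors. -/
noncomputable abbrev galWitt (p n : ℕ) [Fact p.Prime] (σ : L ≃ₐ[K] L) :
    TruncatedWittVector p n L →+* TruncatedWittVector p n L :=
  wittMap n (σ : L →+* L)

theorem galWitt_wittMap (σ : L ≃ₐ[K] L) (x : TruncatedWittVector p n K) :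
    galWitt p n σ (wittMap n (algebraMap K L) x) = wittMap n (algebraMap K L) x := by
  ext i; simp

theorem exists_wittMap_eq [IsGalois K L] {x : TruncatedWittVector p n L}
    (hx : ∀ σ : L ≃ₐ[K] L, galWitt p n σ x = x) : ∃ y, wittMap n (algebraMap K L) y = x := by
  have h (i : Fin n) : ∃ a : K, algebraMap K L a = x.coeff i := by
    refine (InfiniteGalois.mem_range_algebraMap_iff_fixed _).2 fun σ => ?_
    have := congrArg (fun z => z.coeff i) (hx σ)
    simpa using this
  choose a ha using h
  exact ⟨TruncatedWittVector.mk p a, by ext i; simp [ha]⟩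

end Descent

/-! ### Characters as coboundaries -/

section Hilbert

variable {K L : Type*} [Field K] [Field L] [Algebra K L] [IsGalois K L] {p n : ℕ} [Fact p.Prime]

/-- A character of a Galois group factoring through a finite quotient is a coboundary, both in the
units of the group algebra and in the truncated Witt vectors. -/
theorem exists_of_character [CharP L p] (χ : (L ≃ₐ[K] L) →* Multiplicative (ZMod (p ^ n)))
    (s : Set L) [Finite s] (hχ : ∀ σ : L ≃ₐ[K] L, (∀ e ∈ s, σ e = e) → χ σ = 1) :
    (∃ x : L[Multiplicative (ZMod (p ^ n))], aug L _ x = 1 ∧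
      ∀ σ : L ≃ₐ[K] L, galCoeff _ σ x = x * single (χ σ) 1) ∧
    ∃ y : TruncatedWittVector p n L,
      ∀ σ : L ≃ₐ[K] L, galWitt p n σ y = y + constHom p n L (χ σ).toAdd := by
  classical
  let E := FiniteGaloisIntermediateField.adjoin K s
  have hE : s ⊆ E.toIntermediateField := FiniteGaloisIntermediateField.subset_adjoin K s
  let res (σ : L ≃ₐ[K] L) : E ≃ₐ[K] E := σ.restrictNormal E
  have hres (σ : L ≃ₐ[K] L) (e : E) : σ (algebraMap E L e) = algebraMap E L (res σ e) :=
    (AlgEquiv.restrictNormal_commutes σ E e).symm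
  let κ (τ : E ≃ₐ[K] E) : Multiplicative (ZMod (p ^ n)) := χ (τ.liftNormal L)
  have hκ (σ : L ≃ₐ[K] L) (τ : E ≃ₐ[K] E) : κ (res σ * τ) = χ σ * κ τ := by
    -- Two automorphisms of `L` with the same restriction to `E` differ by one fixing `s`, so `κ`
    -- does not depend on the chosen lifts.
    have : χ ((σ * τ.liftNormal L)⁻¹ * (res σ * τ).liftNormal L) = 1 := by
      refine hχ _ fun e he => ?_
      have h1 (τ : E ≃ₐ[K] E) : τ.liftNormal L e = algebraMap E L (τ ⟨e, hE he⟩) :=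
        AlgEquiv.liftNormal_commutes τ L ⟨e, hE he⟩
      rw [AlgEquiv.mul_apply, h1, AlgEquiv.mul_apply, ← hres, ← h1]
      exact AlgEquiv.symm_apply_apply (σ * τ.liftNormal L) e
    rw [map_mul, map_inv, map_mul] at this
    exact (inv_mul_eq_one.1 this).symm
  have reindex {M : Type _} [AddCommMonoid M] (σ : L ≃ₐ[K] L) (f : (E ≃ₐ[K] E) → M) :
      ∑ τ, f τ = ∑ τ, f (res σ * τ) := (Equiv.sum_comp (Equiv.mulLeft (res σ)) f).symm
  -- Trace one makes the weighted sum over the finite Galois group have augmentation `1`, and makes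
  -- its Witt analogue invertible.
  obtain ⟨c, hc⟩ := Algebra.trace_surjective K E 1
  have hc' : ∑ τ : E ≃ₐ[K] E, algebraMap E L (τ c) = 1 := by
    rw [← map_sum, ← trace_eq_sum_automorphisms, hc, map_one, map_one]
  refine ⟨⟨∑ τ : E ≃ₐ[K] E, single (κ τ)⁻¹ (algebraMap E L (τ c)), ?_, fun σ => ?_⟩, ?_⟩
  · rw [map_sum]
    simpa using hc'
  · rw [map_sum, Finset.sum_mul, reindex σ fun τ => single (κ τ)⁻¹ _ * _]
    refine Finset.sum_congr rfl fun τ _ => ?_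
    rw [mapRingHom_single, single_mul_single, hκ, mul_one, mul_inv,
      mul_comm (χ σ)⁻¹, inv_mul_cancel_right, AlgEquiv.mul_apply, ← hres]
    rfl
  · let t (τ : E ≃ₐ[K] E) : TruncatedWittVector p n L :=
      WittVector.truncate n (WittVector.teichmuller p (algebraMap E L (τ c)))
    have ht (σ : L ≃ₐ[K] L) (τ : E ≃ₐ[K] E) : galWitt p n σ (t τ) = t (res σ * τ) := by
      rw [wittMap_truncate, WittVector.map_teichmuller]
      simp only [t, AlgEquiv.mul_apply, ← hres]
      rfl
    -- Teichmüller lifts are not additive, so this sum need not be `1`; only its zeroth coefficient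
    -- is the trace, which suffices for a unit.
    have hT : IsUnit (∑ τ, t τ) := by
      simp only [t, ← map_sum]
      refine isUnit_truncate ?_
      rw [← WittVector.constantCoeff_apply, map_sum]
      simp only [WittVector.constantCoeff_apply, WittVector.teichmuller_coeff_zero, hc']
      exact one_ne_zero
    obtain ⟨u, hu⟩ := hT.exists_left_inv
    have hTσ (σ : L ≃ₐ[K] L) : galWitt p n σ (∑ τ, t τ) = ∑ τ, t τ := by
      rw [map_sum, reindex σ t]
      exact Finset.sum_congr rfl fun τ _ => ht σ τ
    have huσ (σ : L ≃ₐ[K] L) : galWitt p n σ u = u := by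
      have := congrArg (galWitt p n σ) hu
      rw [map_mul, hTσ, map_one, ← hu] at this
      exact hT.mul_right_cancel this
    -- Applying `σ` to the weighted sum subtracts `χ σ` times the plain sum; the factor `-u` turns
    -- this into adding `χ σ`.
    refine ⟨-u * ∑ τ, constHom p n L (κ τ).toAdd * t τ, fun σ => ?_⟩
    have h1 : ∑ τ, constHom p n L (κ τ).toAdd * t τ =
        galWitt p n σ (∑ τ, constHom p n L (κ τ).toAdd * t τ) +
          constHom p n L (χ σ).toAdd * ∑ τ, t τ := by
      conv_lhs => rw [reindex σ]
      rw [map_sum, reindex σ t, Finset.mul_sum, ← Finset.sum_add_distrib]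
      refine Finset.sum_congr rfl fun τ _ => ?_
      rw [hκ, toAdd_mul, map_add, map_mul, wittMap_constHom, ht]
      ring
    rw [map_mul, map_neg, huσ]
    linear_combination u * h1 + constHom p n L (χ σ).toAdd * hu

end Hilbert

theorem IsCocycle.isUnit {R G : Type*} [CommRing R] [CommGroup G] (p k : ℕ) [Fact p.Prime]
    [CharP R p] (hG : ∀ g : G, g ^ p ^ k = 1) {J : R[G × G]} (hJ : IsCocycle J) : IsUnit J := by
  refine isUnit_of_aug_eq_one p k (fun g => Prod.ext (hG _) (hG _)) ?_
  rw [← aug_push (MonoidHom.fst G G), hJ.fst_eq_one, map_one]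

theorem zmod_pow_eq_one (p n : ℕ) (g : Multiplicative (ZMod (p ^ n))) : g ^ p ^ n = 1 := by
  rw [← toAdd_eq_zero, toAdd_pow, nsmul_eq_mul, CharP.cast_eq_zero, zero_mul]

/-! ### Twists and Witt vectors with the same Galois character -/

section Comparison

variable {K : Type*} (L : Type*) [Field K] [Field L] [Algebra K L] {p n : ℕ} [Fact p.Prime]

/-- The twist `J` of the group algebra of `ℤ/pⁿℤ` and the Witt vector `w` correspond to the same
character of the Galois group of `L / K`. -/
def Related (J : K[Multiplicative (ZMod (p ^ n)) × Multiplicative (ZMod (p ^ n))])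
    (w : TruncatedWittVector p n K) [CharP L p] : Prop :=
  ∃ (x : L[Multiplicative (ZMod (p ^ n))]) (y : TruncatedWittVector p n L),
    Splits (coeffMap _ (algebraMap K L) J) x ∧ wittP p n L y = wittMap n (algebraMap K L) w ∧
    ∀ σ : L ≃ₐ[K] L, ∃ k : ZMod (p ^ n), galWitt p n σ y = y + constHom p n L k ∧
      galCoeff _ σ x = x * single (Multiplicative.ofAdd k) 1

variable {L} [CharP K p] [CharP L p]
  {I J : K[Multiplicative (ZMod (p ^ n)) × Multiplicative (ZMod (p ^ n))]}
  {v w : TruncatedWittVector p n K}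

omit [CharP K p] in
theorem related_one_zero :
    Related L (1 : K[Multiplicative (ZMod (p ^ n)) × Multiplicative (ZMod (p ^ n))]) 0 :=
  ⟨1, 0, by rw [map_one]; exact Splits.one, by rw [map_zero, map_zero], fun σ =>
    ⟨0, by simp only [map_zero, add_zero], by rw [map_one, one_mul]; rfl⟩⟩

omit [CharP K p] in
theorem Related.mul_add (h : Related L I v) (k : Related L J w) : Related L (I * J) (v + w) := by
  obtain ⟨x, y, h1, h2, h3⟩ := h
  obtain ⟨x', y', k1, k2, k3⟩ := k
  refine ⟨x * x', y + y', by rw [map_mul]; exact h1.mul k1, by rw [map_add, h2, k2, map_add],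
    fun σ => ?_⟩
  obtain ⟨a, h4, h5⟩ := h3 σ
  obtain ⟨b, k4, k5⟩ := k3 σ
  refine ⟨a + b, by rw [map_add, h4, k4, map_add]; abel, ?_⟩
  rw [map_mul, h5, k5, mul_mul_mul_comm, single_mul_single, mul_one, ofAdd_add]

theorem isUnit_of_aug {x : L[Multiplicative (ZMod (p ^ n))]} (hx : aug L _ x = 1) : IsUnit x :=
  isUnit_of_aug_eq_one p n (zmod_pow_eq_one p n) hx

omit [CharP K p] in
theorem Related.inv_neg (h : Related L I v) (hIJ : I * J = 1) : Related L J (-v) := by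
  obtain ⟨x, y, h1, h2, h3⟩ := h
  obtain ⟨x', hx'⟩ := (isUnit_of_aug h1.aug_eq_one).exists_right_inv
  refine ⟨x', -y, h1.inv (by rw [← map_mul, hIJ, map_one]) hx', by rw [map_neg, h2, map_neg],
    fun σ => ?_⟩
  obtain ⟨a, h4, h5⟩ := h3 σ
  refine ⟨-a, by rw [map_neg, h4, map_neg]; abel, ?_⟩
  have h6 : single (Multiplicative.ofAdd a) (1 : L) * single (Multiplicative.ofAdd (-a)) 1 = 1 := by
    rw [single_mul_single, ← ofAdd_add, add_neg_cancel, mul_one]; rfl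
  have h7 := congrArg (galCoeff _ σ) hx'
  rw [map_mul, map_one, h5] at h7
  calc galCoeff _ σ x' = galCoeff _ σ x' * (x * x') *
        (single (Multiplicative.ofAdd a) (1 : L) * single (Multiplicative.ofAdd (-a)) 1) := by
          rw [hx', h6, mul_one, mul_one]
    _ = x * single (Multiplicative.ofAdd a) 1 * galCoeff _ σ x' * x' *
        single (Multiplicative.ofAdd (-a)) 1 := by ring
    _ = _ := by rw [h7, one_mul]

/-- Two splittings of a twist differ by an element of the group. -/
theorem Splits.exists_eq_mul_single
    {J : L[Multiplicative (ZMod (p ^ n)) × Multiplicative (ZMod (p ^ n))]}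
    {x x' : L[Multiplicative (ZMod (p ^ n))]} (h : Splits J x) (h' : Splits J x')
    (hJ : IsUnit J) : ∃ g, x' = x * MonoidAlgebra.single g 1 := by
  have hx := isUnit_of_aug h.aug_eq_one
  obtain ⟨z, hz⟩ := hx.exists_right_inv
  have hu : x' = x * (z * x') := by rw [← mul_assoc, hz, one_mul]
  obtain ⟨g, hg⟩ := (h.isMultiplicative_of_eq_mul h' hx hJ hu).exists_eq_single (by
    have := congrArg (aug L _) hu
    rw [map_mul, h'.aug_eq_one, h.aug_eq_one, one_mul] at this
    exact this.symm)
  exact ⟨g, by rw [hu, hg]⟩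

theorem single_injective_of_isUnit {G : Type*} [CommGroup G] {x : L[G]} (hx : IsUnit x) {g h : G}
    (e : x * single g 1 = x * single h 1) : g = h :=
  (single_left_inj one_ne_zero).1 (hx.mul_left_cancel e)

theorem galCoeff_single {G : Type*} [CommGroup G] (σ : L ≃ₐ[K] L) (g : G) :
    galCoeff G σ (single g 1) = single g 1 := by
  rw [mapRingHom_single, map_one]

theorem galCoeff_mul {G : Type*} [CommGroup G] (σ τ : L ≃ₐ[K] L) (x : L[G]) :
    galCoeff G (σ * τ) x = galCoeff G σ (galCoeff G τ x) := by
  ext g; simp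

omit [CharP K p] [CharP L p] in
theorem galWitt_mul (σ τ : L ≃ₐ[K] L) (y : TruncatedWittVector p n L) :
    galWitt p n (σ * τ) y = galWitt p n σ (galWitt p n τ y) := by
  ext i; simp

/-- A splitting `x` over `L` is moved by `σ` by a group element `χ σ`, trivial when `σ` fixes the
finitely many coefficients of `x`. Writing this character as the coboundary of some `y`, the vector
`F(y) - y` is Galois invariant and descends to `w`. -/
theorem exists_related_right [IsGalois K L] [IsSepClosed L] (hJ : IsCocycle J) :
    ∃ w, Related L J w := by
  have hJu : IsUnit J := hJ.isUnit p n (zmod_pow_eq_one p n)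
  have : NeZero (p ^ n) := ⟨pow_ne_zero _ (Nat.Prime.ne_zero Fact.out)⟩
  have : Fintype (Multiplicative (ZMod (p ^ n))) := Fintype.ofFinite _
  obtain ⟨x, hx⟩ := hJ.exists_splits p n (zmod_pow_eq_one p n) hJu L
  have hxu := isUnit_of_aug hx.aug_eq_one
  have hσ (σ : L ≃ₐ[K] L) : ∃ g, galCoeff _ σ x = x * single g 1 := by
    refine hx.exists_eq_mul_single ?_ (hJu.map _)
    have := hx.coeffMap (σ : L →+* L)
    rwa [galCoeff_coeffMap] at this
  choose χ hχ using hσ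
  obtain ⟨-, y, hy⟩ := exists_of_character (K := K) (L := L) (p := p) (n := n)
    (MonoidHom.mk' χ fun σ τ => by
      refine single_injective_of_isUnit hxu ?_
      rw [← hχ, galCoeff_mul, hχ τ, map_mul, hχ σ, galCoeff_single, mul_assoc, single_mul_single,
        mul_one])
    (Set.range x.coeff) (fun σ h => by
      refine single_injective_of_isUnit hxu ((hχ σ).symm.trans ?_)
      rw [← one_def, mul_one]
      ext g
      exact (coeff_mapRingHom _ _ _).trans (h _ ⟨g, rfl⟩))
  obtain ⟨w, hw⟩ := exists_wittMap_eq (K := K) (x := wittP p n L y) fun σ => by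
    rw [wittMap_wittP, hy, map_add, wittP_constHom, add_zero]
  exact ⟨w, x, y, hx, hw.symm, fun σ => ⟨_, hy σ, hχ σ⟩⟩

-- The mirror image of `exists_related_right`: a solution of `F(y) - y = w` over `L` gives the
-- character, an `x` with that character is produced, and its coboundary descends to `K`, where it
-- remains a cocycle.
omit [CharP K p] in
theorem exists_related_left [IsGalois K L] [IsSepClosed L] (w : TruncatedWittVector p n K) :
    ∃ J, IsCocycle J ∧ Related L J w := by
  obtain ⟨y, hy⟩ := exists_wittP_eq (wittMap n (algebraMap K L) w)
  have hσ (σ : L ≃ₐ[K] L) : ∃ k, galWitt p n σ y = y + constHom p n L k := by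
    obtain ⟨k, hk⟩ := exists_constHom_eq (y := galWitt p n σ y - y) (by
      rw [map_sub, ← wittMap_wittP, hy, galWitt_wittMap, sub_self])
    exact ⟨k, by rw [hk]; abel⟩
  choose χ hχ using hσ
  obtain ⟨⟨x, hx1, hx⟩, -⟩ := exists_of_character (K := K) (L := L) (p := p) (n := n)
    (MonoidHom.mk' (fun σ => Multiplicative.ofAdd (χ σ)) fun σ τ => by
      refine congrArg Multiplicative.ofAdd (constHom_injective (R := L) (p := p) ?_)
      refine add_left_cancel (a := y) ?_
      change _ = y + constHom p n L (χ σ + χ τ)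
      rw [← hχ, galWitt_mul, hχ τ, map_add, hχ σ, wittMap_constHom, map_add, add_assoc])
    (Set.range fun i => y.coeff i) (fun σ h => by
      refine congrArg Multiplicative.ofAdd (constHom_injective (R := L) (p := p) (a₂ := 0) ?_)
      refine add_left_cancel (a := y) ((hχ σ).symm.trans ?_)
      rw [map_zero, add_zero]
      ext i
      exact (coeff_wittMap _ _ _).trans (h _ ⟨i, rfl⟩))
  have hxu := isUnit_of_aug hx1
  obtain ⟨z, hz⟩ := hxu.exists_right_inv
  have key (f : Multiplicative (ZMod (p ^ n)) →*
      Multiplicative (ZMod (p ^ n)) × Multiplicative (ZMod (p ^ n))) :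
      push L f z * push L f x = 1 := by
    rw [← map_mul, mul_comm, hz, map_one]
  obtain ⟨J', hJ'⟩ : ∃ J', Splits J' x := ⟨push L (diag _) x *
    (push L (MonoidHom.inl _ _) z * push L (MonoidHom.inr _ _) z), hx1, by
      rw [mul_assoc, mul_mul_mul_comm, key, key, mul_one, mul_one]⟩
  obtain ⟨J, rfl⟩ := exists_coeffMap_eq (K := K) (x := J') fun σ => by
    have h1 := hJ'.coeffMap (σ : L →+* L)
    rw [hx σ] at h1
    have h2 := hJ'.mul (Splits.single (R := L) (Multiplicative.ofAdd (χ σ)))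
    rw [mul_one] at h2
    exact h1.eq_of_splits h2 (isUnit_of_aug h2.aug_eq_one)
  exact ⟨J, isCocycle_of_coeffMap (algebraMap K L).injective (hJ'.isCocycle hxu), x, y, hJ', hy,
    fun σ => ⟨χ σ, hχ σ, hx σ⟩⟩

/-- Either condition forces the common character to be trivial, and then the other solution is
Galois invariant and descends to `K`. -/
theorem Related.exists_splits_iff [IsGalois K L] (h : Related L J w) (hJ : IsUnit J) :
    (∃ z, Splits J z) ↔ w ∈ (wittP p n K).range := by
  obtain ⟨x, y, h1, h2, h3⟩ := h
  have hxu := isUnit_of_aug h1.aug_eq_one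
  constructor
  · rintro ⟨z, hz⟩
    obtain ⟨g, hg⟩ := (hz.coeffMap (algebraMap K L)).exists_eq_mul_single h1 (hJ.map _)
    obtain ⟨y', rfl⟩ := exists_wittMap_eq (K := K) (x := y) fun σ => by
      obtain ⟨k, h4, h5⟩ := h3 σ
      have h6 : galCoeff _ σ x = x * single 1 1 := by
        rw [hg, map_mul, galCoeff_coeffMap, galCoeff_single, ← one_def, mul_one]
      have h7 : k = 0 := Multiplicative.ofAdd.injective
        (single_injective_of_isUnit hxu (h5.symm.trans h6))
      rw [h4, h7, map_zero, add_zero]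
    rw [← wittMap_wittP] at h2
    exact ⟨y', wittMap_injective (algebraMap K L).injective h2⟩
  · rintro ⟨y', rfl⟩
    rw [wittMap_wittP] at h2
    -- `y` may differ from `y'`, but only by an element of `W_n(𝔽_p)`, which is Galois invariant as
    -- well.
    obtain ⟨j, hj⟩ := exists_constHom_eq (y := y - wittMap n (algebraMap K L) y')
      (by rw [map_sub, h2, sub_self])
    obtain ⟨z, rfl⟩ := exists_coeffMap_eq (K := K) (x := x) fun σ => by
      obtain ⟨k, h4, h5⟩ := h3 σ
      have h6 : galWitt p n σ y = y := by
        have := congrArg (galWitt p n σ) hj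
        rw [wittMap_constHom, map_sub, galWitt_wittMap, hj] at this
        exact (sub_left_injective this).symm
      have h7 : k = 0 := constHom_injective (R := L) (p := p) (by
        rw [h6] at h4
        rw [map_zero]
        exact left_eq_add.1 h4)
      rw [h5, h7, ofAdd_zero, ← one_def, mul_one]
    refine ⟨z, ?_, coeffMap_algebraMap_injective (K := K) (L := L) ?_⟩
    · have := h1.aug_eq_one
      rw [aug_coeffMap, ← map_one (algebraMap K L)] at this
      exact (algebraMap K L).injective this
    · simpa only [map_mul, coeffMap_push] using h1.diag_eq

end Comparison

/-! ### From `K[G] ⊗ K[G]` to `K[G × G]` -/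

section Transport

variable (K : Type*) [CommRing K] (G H : Type*) [CommGroup G] [CommGroup H]

/-- `K[G] ⊗ K[H] ≃ K[G × H]` as algebras. -/
noncomputable def tensorAlgEquiv : K[G] ⊗[K] K[H] ≃ₐ[K] K[G × H] :=
  AlgEquiv.ofBijective
    (Algebra.TensorProduct.lift (mapDomainAlgHom K K (MonoidHom.inl G H))
      (mapDomainAlgHom K K (MonoidHom.inr G H)) fun _ _ => Commute.all _ _) (by
    convert (tensorEquiv K (M := G) (N := H)).bijective using 1
    funext x
    induction x with
    | zero => simp
    | add x y hx hy => rw [map_add, hx, hy, map_add]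
    | tmul x y =>
      induction x using MonoidAlgebra.induction_linear with
      | zero => simp
      | add a b ha hb => rw [TensorProduct.add_tmul, map_add, ha, hb, map_add]
      | single g r =>
        induction y using MonoidAlgebra.induction_linear with
        | zero => simp
        | add a b ha hb => rw [TensorProduct.tmul_add, map_add, ha, hb, map_add]
        | single h s => simp)

variable {K G H}

theorem tensorAlgEquiv_tmul (x : K[G]) (y : K[H]) : tensorAlgEquiv K G H (x ⊗ₜ y) =
    push K (MonoidHom.inl G H) x * push K (MonoidHom.inr G H) y := by
  simp [tensorAlgEquiv]

theorem tensorAlgEquiv_single (g : G) (h : H) (r s : K) :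
    tensorAlgEquiv K G H (single g r ⊗ₜ single h s) = single (g, h) (r * s) := by
  rw [tensorAlgEquiv_tmul, push_single, push_single, single_mul_single]
  simp

variable (K G) in
/-- `K[G] ⊗ (K[G] ⊗ K[G]) ≃ K[G × (G × G)]` as algebras. -/
noncomputable def tensorAlgEquiv₃ : K[G] ⊗[K] (K[G] ⊗[K] K[G]) ≃ₐ[K] K[G × (G × G)] :=
  (Algebra.TensorProduct.congr AlgEquiv.refl (tensorAlgEquiv K G G)).trans
    (tensorAlgEquiv K G (G × G))

theorem tensorAlgEquiv₃_single (g h k : G) :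
    tensorAlgEquiv₃ K G (single g 1 ⊗ₜ (single h 1 ⊗ₜ single k 1)) = single (g, h, k) 1 := by
  simp [tensorAlgEquiv₃, tensorAlgEquiv_single]

theorem algHom_ext_single {S : Type*} [CommRing S] [Algebra K S] {f g : K[G] →ₐ[K] S}
    (h : ∀ a : G, f (single a 1) = g (single a 1)) : f = g :=
  MonoidAlgebra.algHom_ext h (by ext)

/-- All structure maps in the definition of a twist are algebra maps, so this reduces their
translation to tensors of group elements. -/
theorem algHom_ext_of_push {S : Type*} [CommRing S] [Algebra K S] (f : K[G] ⊗[K] K[G] →ₐ[K] S)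
    (g : K[G × G] →ₐ[K] S)
    (h : ∀ a b : G, f (single a 1 ⊗ₜ single b 1) = g (single (a, b) 1)) (J : K[G] ⊗[K] K[G]) :
    f J = g (tensorAlgEquiv K G G J) := by
  have : f = g.comp (tensorAlgEquiv K G G).toAlgHom := by
    refine Algebra.TensorProduct.ext ?_ ?_
    · refine algHom_ext_single fun a => ?_
      simpa [tensorAlgEquiv_single, one_def] using h a 1
    · refine algHom_ext_single fun a => ?_
      simpa [tensorAlgEquiv_single, one_def] using h 1 a
  exact DFunLike.congr_fun this J

theorem comulLeft_eq (J : K[G] ⊗[K] K[G]) : tensorAlgEquiv₃ K G (comulLeft K K[G] J) =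
    push K (dupLeft G) (tensorAlgEquiv K G G J) :=
  algHom_ext_of_push ((tensorAlgEquiv₃ K G).toAlgHom.comp (comulLeft K K[G]))
    (mapDomainAlgHom K K (dupLeft G)) (fun a b => by
      simp [comulLeft, tensorAlgEquiv₃_single, dupLeft]) J

theorem comulRight_eq (J : K[G] ⊗[K] K[G]) : tensorAlgEquiv₃ K G (comulRight K K[G] J) =
    push K (dupRight G) (tensorAlgEquiv K G G J) :=
  algHom_ext_of_push ((tensorAlgEquiv₃ K G).toAlgHom.comp (comulRight K K[G]))
    (mapDomainAlgHom K K (dupRight G)) (fun a b => by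
      simp [comulRight, tensorAlgEquiv₃_single, dupRight]) J

theorem tensorOne_eq (J : K[G] ⊗[K] K[G]) : tensorAlgEquiv₃ K G (tensorOne K K[G] J) =
    push K (inclLeft G) (tensorAlgEquiv K G G J) :=
  algHom_ext_of_push ((tensorAlgEquiv₃ K G).toAlgHom.comp (tensorOne K K[G]))
    (mapDomainAlgHom K K (inclLeft G)) (fun a b => by
      simp [tensorOne, one_def, tensorAlgEquiv₃_single, inclLeft]) J

theorem oneTensor_eq (J : K[G] ⊗[K] K[G]) : tensorAlgEquiv₃ K G (oneTensor K K[G] J) =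
    push K (inclRight G) (tensorAlgEquiv K G G J) :=
  algHom_ext_of_push ((tensorAlgEquiv₃ K G).toAlgHom.comp (oneTensor K K[G]))
    (mapDomainAlgHom K K (inclRight G)) (fun a b => by
      simp [oneTensor, one_def, tensorAlgEquiv₃_single, inclRight]) J

theorem counitLeft_eq (J : K[G] ⊗[K] K[G]) : counitLeft K K[G] J =
    push K (MonoidHom.snd G G) (tensorAlgEquiv K G G J) :=
  algHom_ext_of_push (counitLeft K K[G]) (mapDomainAlgHom K K (MonoidHom.snd G G))
    (fun a b => by simp [counitLeft]) J

theorem counitRight_eq (J : K[G] ⊗[K] K[G]) : counitRight K K[G] J =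
    push K (MonoidHom.fst G G) (tensorAlgEquiv K G G J) :=
  algHom_ext_of_push (counitRight K K[G]) (mapDomainAlgHom K K (MonoidHom.fst G G))
    (fun a b => by simp [counitRight]) J

theorem comul_eq (x : K[G]) : tensorAlgEquiv K G G (Bialgebra.comulAlgHom K K[G] x) =
    push K (diag G) x := by
  have : (tensorAlgEquiv K G G).toAlgHom.comp (Bialgebra.comulAlgHom K K[G]) =
      mapDomainAlgHom K K (diag G) := by
    refine algHom_ext_single fun a => ?_
    simp [tensorAlgEquiv_single, diag]
  exact DFunLike.congr_fun this x

theorem counit_eq (x : K[G]) : Coalgebra.counit (R := K) x = aug K G x := by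
  have : Bialgebra.counitAlgHom K K[G] = aug K G := by
    refine algHom_ext_single fun a => ?_
    simp
  exact DFunLike.congr_fun this x

theorem isTwist_iff (J : (K[G] ⊗[K] K[G])ˣ) :
    IsTwist J ↔ IsCocycle (tensorAlgEquiv K G G J) := by
  constructor
  · rintro ⟨h1, h2, h3⟩
    refine ⟨?_, by rw [← counitLeft_eq, h2], by rw [← counitRight_eq, h3]⟩
    rw [← comulLeft_eq, ← comulRight_eq, ← tensorOne_eq, ← oneTensor_eq, ← map_mul, h1, map_mul]
  · rintro ⟨h1, h2, h3⟩
    refine ⟨(tensorAlgEquiv₃ K G).injective ?_, by rw [counitLeft_eq, h2],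
      by rw [counitRight_eq, h3]⟩
    rw [map_mul, map_mul, comulLeft_eq, comulRight_eq, tensorOne_eq, oneTensor_eq, h1]

theorem gaugeEquivalent_one_iff (p k : ℕ) [Fact p.Prime] [CharP K p]
    (hG : ∀ g : G, g ^ p ^ k = 1) (J : (K[G] ⊗[K] K[G])ˣ) :
    GaugeEquivalent 1 J ↔ ∃ x, Splits (tensorAlgEquiv K G G J) x := by
  have key (x : K[G]ˣ) : J = gaugeTransform x 1 ↔ push K (diag G) (x : K[G]) =
      tensorAlgEquiv K G G J * (push K (MonoidHom.inl G G) x * push K (MonoidHom.inr G G) x) := by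
    rw [gaugeTransform, mul_one, map_inv, map_inv, ← mul_inv, eq_mul_inv_iff_mul_eq, ← comul_eq,
      ← tensorAlgEquiv_tmul, ← map_mul, (tensorAlgEquiv K G G).injective.eq_iff, eq_comm,
      Units.ext_iff]
    simp
  constructor
  · rintro ⟨x, h1, h2⟩
    exact ⟨x, by rw [← counit_eq, h1], (key x).1 h2⟩
  · rintro ⟨x, h1, h2⟩
    obtain ⟨u, rfl⟩ := isUnit_of_aug_eq_one p k hG h1
    exact ⟨u, by rw [counit_eq, h1], (key u).2 h2⟩

end Transport

/-! ### The isomorphism obtained from the correspondence -/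

section Iso

variable (p n : ℕ) [Fact p.Prime] (K : Type*) [Field K] [CharP K p]

/-- A correspondence between two groups which is total on both sides and matches the kernels of two
surjective homomorphisms induces an isomorphism of their targets. -/
theorem nonempty_addEquiv_of_correspondence {M N M' N' : Type*} [AddGroup M] [AddGroup N]
    [AddGroup M'] [AddGroup N'] (Γ : AddSubgroup (M × N)) (f : M →+ M') (g : N →+ N')
    (hf : Function.Surjective f) (hg : Function.Surjective g) (hM : ∀ m, ∃ n, (m, n) ∈ Γ)
    (hN : ∀ n, ∃ m, (m, n) ∈ Γ) (hker : ∀ q ∈ Γ, f q.1 = 0 ↔ g q.2 = 0) : Nonempty (M' ≃+ N') := by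
  let f' : Γ →+ M' := (f.comp (AddMonoidHom.fst M N)).comp Γ.subtype
  let g' : Γ →+ N' := (g.comp (AddMonoidHom.snd M N)).comp Γ.subtype
  have hf' : Function.Surjective f' := fun c => by
    obtain ⟨m, rfl⟩ := hf c
    obtain ⟨n, h⟩ := hM m
    exact ⟨⟨_, h⟩, rfl⟩
  have hg' : Function.Surjective g' := fun c => by
    obtain ⟨n, rfl⟩ := hg c
    obtain ⟨m, h⟩ := hN n
    exact ⟨⟨_, h⟩, rfl⟩
  have hk : f'.ker = g'.ker := by
    ext q
    exact hker q.1 q.2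
  exact ⟨(QuotientAddGroup.quotientKerEquivOfSurjective f' hf').symm.trans
    ((QuotientAddGroup.quotientAddEquivOfEq hk).trans
      (QuotientAddGroup.quotientKerEquivOfSurjective g' hg'))⟩

/-- The pairs of a twist and a Witt vector which are related. -/
def relatedSubgroup (L : Type*) [Field L] [Algebra K L] [CharP L p] :
    AddSubgroup (Additive (twistGroup K K[Multiplicative (ZMod (p ^ n))]) ×
      TruncatedWittVector p n K) where
  carrier := {q | Related L (tensorAlgEquiv K _ _ q.1.toMul.1.1) q.2}
  zero_mem' := by
    change Related L (tensorAlgEquiv K _ _ 1) 0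
    rw [map_one]
    exact related_one_zero
  add_mem' := by
    rintro ⟨I, v⟩ ⟨J, w⟩ h k
    change Related L (tensorAlgEquiv K _ _ (I.toMul.1.1 * J.toMul.1.1)) (v + w)
    rw [map_mul]
    exact Related.mul_add h k
  neg_mem' := by
    rintro ⟨I, v⟩ h
    refine Related.inv_neg h ?_
    change tensorAlgEquiv K _ _ I.toMul.1.1 * tensorAlgEquiv K _ _ (I.toMul.1⁻¹).1 = 1
    rw [← map_mul, Units.mul_inv, map_one]

omit [CharP K p] in
theorem mem_relatedSubgroup {L : Type*} [Field L] [Algebra K L] [CharP L p]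
    {J : twistGroup K K[Multiplicative (ZMod (p ^ n))]} {w : TruncatedWittVector p n K} :
    (Additive.ofMul J, w) ∈ relatedSubgroup p n K L ↔
      Related L (tensorAlgEquiv K _ _ J.1.1) w := Iff.rfl

theorem mk'_gaugeCon_eq_one_iff {H : Type*} [CommRing H] [HopfAlgebra K H] (J : twistGroup K H) :
    (gaugeCon K H).mk' J = 1 ↔ GaugeEquivalent 1 J.1 := by
  rw [eq_comm]
  exact (gaugeCon K H).eq (a := 1) (b := J)

/-- Twist classes of the group algebra of `ℤ/pⁿℤ` are classified by `W_n(K) / (F - 1)`. -/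
theorem nonempty_H2inv_addEquiv :
    Nonempty (Additive (H2inv (Multiplicative (ZMod (p ^ n))) K) ≃+
      TruncatedWittVector p n K ⧸ (wittP p n K).range) := by
  let L := SeparableClosure K
  have : CharP L p := charP_of_injective_algebraMap (algebraMap K L).injective p
  refine nonempty_addEquiv_of_correspondence (relatedSubgroup p n K L)
    (MonoidHom.toAdditive (gaugeCon K K[Multiplicative (ZMod (p ^ n))]).mk')
    (QuotientAddGroup.mk' _)
    (fun c => (gaugeCon K K[Multiplicative (ZMod (p ^ n))]).mk'_surjective c.toMul) (QuotientAddGroup.mk'_surjective _) ?_ ?_ ?_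
  · intro J
    obtain ⟨w, hw⟩ := exists_related_right (L := L) ((isTwist_iff J.toMul.1).1 J.toMul.2)
    exact ⟨w, (mem_relatedSubgroup p n K (J := J.toMul)).2 hw⟩
  · intro w
    obtain ⟨J, hJ, hw⟩ := exists_related_left (L := L) w
    obtain ⟨u, hu⟩ := (hJ.isUnit p n (zmod_pow_eq_one p n)).map
      (tensorAlgEquiv K (Multiplicative (ZMod (p ^ n))) (Multiplicative (ZMod (p ^ n)))).symm
    have hΨ : tensorAlgEquiv K _ _ u.1 = J := by rw [hu, AlgEquiv.apply_symm_apply]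
    refine ⟨Additive.ofMul ⟨u, (isTwist_iff u).2 (hΨ ▸ hJ)⟩, (mem_relatedSubgroup p n K).2 ?_⟩
    rwa [hΨ]
  · rintro ⟨J, w⟩ h
    have h2 := (mem_relatedSubgroup p n K (J := J.toMul)).1 h
    have h1 := mk'_gaugeCon_eq_one_iff K J.toMul
    rw [gaugeEquivalent_one_iff p n (zmod_pow_eq_one p n),
      h2.exists_splits_iff (J.toMul.1.isUnit.map (tensorAlgEquiv K (Multiplicative (ZMod (p ^ n)))
        (Multiplicative (ZMod (p ^ n))))),
      ← QuotientAddGroup.eq_zero_iff] at h1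
    exact h1

end Iso

/-! ### The cokernel of `F - 1` over a finite field -/

section Finite

variable (p n : ℕ) [Fact p.Prime] (F : Type*) [Field F] [Finite F] [CharP F p]

/-- An endomorphism of a finite group has kernel and cokernel of equal size, and the kernel here is
`ℤ/pⁿℤ`. -/
theorem card_coker_wittP :
    Nat.card (TruncatedWittVector p n F ⧸ (wittP p n F).range) = p ^ n := by
  have : Finite (TruncatedWittVector p n F) := inferInstanceAs (Finite (Fin n → F))
  have h1 : Nat.card (wittP p n F).ker = p ^ n := by
    rw [← Nat.card_zmod (p ^ n)]
    refine (Nat.card_congr (Equiv.ofBijective (fun k => ⟨constHom p n F k, wittP_constHom k⟩)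
      ⟨fun a b h => constHom_injective (congrArg Subtype.val h), fun y => ?_⟩)).symm
    obtain ⟨k, hk⟩ := exists_constHom_eq y.2
    exact ⟨k, Subtype.ext hk⟩
  have h2 := AddSubgroup.card_eq_card_quotient_mul_card_addSubgroup (wittP p n F).range
  have h3 := AddSubgroup.card_eq_card_quotient_mul_card_addSubgroup (wittP p n F).ker
  rw [Nat.card_congr (QuotientAddGroup.quotientKerEquivRange (wittP p n F)).toEquiv, h1, h2,
    mul_comm] at h3
  exact Nat.eq_of_mul_eq_mul_left Nat.card_pos h3

/-- For `n = m + 1`, the generator is the class of a Teichmüller element `[c]` with `c ^ p ^ m` not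
of the form `a ^ p - a`. If `p ^ m [c]` were `F(y) - y`, its top coefficient would exhibit `c ^ p ^
m` in that form. -/
theorem exists_addOrderOf_eq :
    ∃ c : TruncatedWittVector p n F ⧸ (wittP p n F).range, addOrderOf c = p ^ n := by
  have : Finite (TruncatedWittVector p n F) := inferInstanceAs (Finite (Fin n → F))
  rcases n with _ | m
  · exact ⟨0, by simp⟩
  have hns : ¬ Function.Surjective fun a : F => a ^ p - a := by
    intro h
    -- `0` and `1` have the same image, so on a finite set the map is not onto either.
    have := (Finite.injective_iff_surjective.2 h) (a₁ := 0) (a₂ := 1)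
      (by simp [(Nat.Prime.ne_zero Fact.out : p ≠ 0)])
    exact zero_ne_one this
  obtain ⟨b, hb⟩ := not_forall.1 hns
  obtain ⟨c, hc⟩ := (PerfectRing.bijective_frobenius (R := F) (p := p)).2.iterate m b
  replace hc : c ^ p ^ m = b := by rw [← hc]; exact (congrFun (pow_iterate p m) c).symm
  refine ⟨QuotientAddGroup.mk' _ (WittVector.truncate (m + 1) (WittVector.teichmuller p c)),
    addOrderOf_eq_prime_pow ?_ ?_⟩
  · rw [← map_nsmul, QuotientAddGroup.mk'_apply, QuotientAddGroup.eq_zero_iff]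
    rintro ⟨y, hy⟩
    obtain ⟨y, rfl⟩ := WittVector.truncate_surjective p (m + 1) F y
    rw [wittP_truncate, ← map_nsmul, nsmul_eq_mul, Nat.cast_pow, mul_comm] at hy
    have hcoeff (i : ℕ) (hi : i < m + 1) := congrArg (TruncatedWittVector.coeff ⟨i, hi⟩) hy
    simp only [WittVector.coeff_truncate] at hcoeff
    -- The first `m` coefficients of `p ^ m [c]` vanish, so `y` truncated to length `m` is killed by
    -- `F - 1` and comes from an integer `k`. Subtracting `k`, which `F` fixes, leaves some `V^m z`.
    obtain ⟨k, hk⟩ := exists_constHom_eq (y := WittVector.truncate m y) (by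
      rw [wittP_truncate]
      ext i
      rw [WittVector.coeff_truncate, hcoeff i (by omega), WittVector.mul_pow_charP_coeff_zero _ i.2,
        TruncatedWittVector.coeff_zero])
    have hz : ∀ i < m, (y - (k.val : WittVector p F)).coeff i = 0 := by
      rw [← WittVector.mem_ker_truncate, RingHom.mem_ker, map_sub, map_natCast, ← hk, sub_eq_zero]
      conv_lhs => rw [← ZMod.natCast_zmod_val k]
      rw [map_natCast]
    obtain ⟨z, hyz⟩ : ∃ z, y - (k.val : WittVector p F) = WittVector.verschiebung^[m] z :=
      ⟨_, WittVector.eq_iterate_verschiebung hz⟩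
    have hF : WittVector.frobenius y - y =
        WittVector.verschiebung^[m] (WittVector.frobenius z - z) := by
      rw [iterate_map_sub, (WittVector.verschiebung_frobenius_comm.iterate_left m).eq z, ← hyz,
        map_sub, map_natCast]
      ring
    have hm := hcoeff m (Nat.lt_succ_self m)
    have h0 := WittVector.iterate_verschiebung_coeff (WittVector.frobenius z - z) m 0
    -- The coefficient of index `m` is `c ^ p ^ m = b` on one side and `z₀ ^ p - z₀` on the other.
    have h1 := WittVector.mul_pow_charP_coeff_succ (WittVector.teichmuller p c) (m := 0) (n := m)
    rw [zero_add] at h0 h1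
    rw [hF, h0, h1, WittVector.teichmuller_coeff_zero, hc, ← WittVector.constantCoeff_apply,
      map_sub, WittVector.constantCoeff_apply, WittVector.constantCoeff_apply,
      WittVector.coeff_frobenius_charP] at hm
    exact hb ⟨_, hm⟩
  · rw [← card_coker_wittP p (m + 1) F]
    exact card_nsmul_eq_zero'

theorem nonempty_coker_addEquiv_zmod :
    Nonempty (TruncatedWittVector p n F ⧸ (wittP p n F).range ≃+ ZMod (p ^ n)) := by
  have : Finite (TruncatedWittVector p n F) := inferInstanceAs (Finite (Fin n → F))
  obtain ⟨c, hc⟩ := exists_addOrderOf_eq p n F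
  have : IsAddCyclic (TruncatedWittVector p n F ⧸ (wittP p n F).range) :=
    isAddCyclic_of_addOrderOf_eq_card c (by rw [hc, card_coker_wittP])
  have e := zmodAddCyclicAddEquiv this
  rw [card_coker_wittP] at e
  exact ⟨e.symm⟩

end Finite

end TwistCohomology

theorem corollary3p5 (p n : ℕ) [Fact p.Prime] :
    (∀ (K : Type*) [Field K] [CharP K p],
      Nonempty (Additive (H2inv (Multiplicative (ZMod (p ^ n))) K) ≃+
        TruncatedWittVector p n K ⧸ (wittP p n K).range)) ∧
    (∀ (F : Type*) [Field F] [Finite F] [CharP F p],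
      Nonempty (Additive (H2inv (Multiplicative (ZMod (p ^ n))) F) ≃+ ZMod (p ^ n))) := by
  refine ⟨fun K _ _ => TwistCohomology.nonempty_H2inv_addEquiv p n K, fun F _ _ _ => ?_⟩
  obtain ⟨e⟩ := TwistCohomology.nonempty_H2inv_addEquiv p n F
  obtain ⟨e'⟩ := TwistCohomology.nonempty_coker_addEquiv_zmod p n F
  exact ⟨e.trans e'⟩
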